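/- Setting. Let $\mathcal X\subseteq\mathbb R^{d_X}$, let $\mathcal A=\{1,\dots,K\}$ be a finite action set, and let $\mathcal P$ be a probability distribution on $\mathcal X\times\mathbb R^K$, the law of a generic $(X,(Y(b))_{b\in\mathcal A})$. Data are collected sequentially at rounds $t=1,2,\dots$. At round $t$ the environment draws a context and potential outcomes $(X_t,(Y_t(b))_{b\in\mathcal A})\sim\mathcal P$, i.i.d. over $t$ and independent of the history $\mathcal H_{t-1}=(X_\tau,\pi_\tau,A_\tau,Y_\tau)_{\tau<t}$. Given $(X_t,\mathcal H_{t-1})$, the agent draws an action $A_t\in\mathcal A$ with $\mathbb P(A_t=b\mid X_t,\mathcal H_{t-1})=\pi_t(b\mid X_t,\mathcal H_{t-1})$, where $\pi_t$ is the behavior policy. The outcome $Y_t=Y_t(A_t)$ and the realized probability $\pi_t=\pi_t(A_t\mid X_t,\mathcal H_{t-1})$ are recorded. Write $\pi_t(b)$ for $\pi_t(b\mid X_t,\mathcal H_{t-1})$. Unconfoundedness is assumed: $A_t$ is independent of $(Y_t(b))_{b\in\mathcal A}$ conditionally on $(\mathcal H_{t-1},X_t)$, for every $t$. Fix an arm $a\in\mathcal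 A$, a score function $g:\mathcal X\times\mathbb R\times\mathbb R^d\to\mathbb R^d$ and a point $\theta_a^*\in\mathbb R^d$ with $\mathbb E[g(X,Y(a);\theta_a^*)]=0$. Assume: 1. (Well-separated root) For every $\epsilon>0$, $\inf_{\|\theta-\theta_a^*\|_2>\epsilon}\|\mathbb E[g(X,Y(a);\theta)]\|_2>0$. 2. (Bounded moments) There are constants $R_\theta,M_2$ such that $\|\mathbb E[g(X,Y(a);\theta_a^*)g(X,Y(a);\theta_a^*)^\top\mid X]\|_2\le M_2$ almost surely, $\|\theta_a^*\|_2<R_\theta$, $\sup_{\|\theta\|_2\le R_\theta}\mathbb E\|g(X,Y(a);\theta)\|_2^2<\infty$, and $\mathbb E\|g(X,Y(a);\theta_a^*)\|_2^4<\infty$. 3. (Smoothness) For all $x,y$ the map $\theta\mapsto g(x,y;\theta)$ is twice differentiable, and $J_a:=\mathbb E[\nabla_\theta g(X,Y(a);\theta_a^*)]$ is nonsingular. There is a function $\phi$ with $\sup_{\|\theta\|_2\le R_\theta}\|\nabla_\theta g(x,y;\theta)\|_2\le\phi(x,y)$ for all $x,y$ and $\mathbb E[\phi(X,Y(a))^2]<\infty$.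 There are $\epsilon_0>0$ and a function $\Phi$ with $\|\nabla_\theta^2g^{(i)}(x,y;\theta)\|_2\le\Phi(x,y)$ for all $x,y$, all coordinates $g^{(i)}$ of $g$ and all $\theta$ with $\|\theta-\theta_a^*\|_2\le\epsilon_0$, and $\mathbb E[\Phi(X,Y(a))]<\infty$. 4. (Minimum sampling probability) There is a constant $\pi_{\min}\in(0,1)$ with $\pi_t(a)\ge\pi_{\min}$ almost surely for all $t$. 5. (Policy convergence at $a$) There is a stationary policy $\bar\pi$, assigning to each $x\in\mathcal X$ a probability distribution $\bar\pi(\cdot\mid x)$ on $\mathcal A$, with $\pi_t(a\mid X_t,\mathcal H_{t-1})-\bar\pi(a\mid X_t)\to0$ in probability as $t\to\infty$. For a dataset of $T$ rounds let $$G_T(\theta)=\frac1T\sum_{t=1}^T\frac{1}{\pi_t(A_t)}1_{\{A_t=a\}}\,g(X_t,Y_t;\theta).$$ Conclusion. There is a sequence of estimators $\hat\theta_a^{(T)}$, each a measurable function of the data of the first $T$ rounds, such that $\|\hat\theta_a^{(T)}\|_2\le R_\theta$ for all $T$ and $G_T(\hat\theta_a^{(T)})=o_p(T^{-1/2})$.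 Moreover, every sequence of random vectors $\hat\theta_a^{(T)}$ with these last two properties satisfies $$\sqrt T\,(\hat\theta_a^{(T)}-\theta_a^*)\xrightarrow{d}\mathcal N\big(0,\;J_a^{-1}\bar I_aJ_a^{-\top}\big),\qquad \bar I_a:=\mathbb E\Big[\frac{1}{\bar\pi(a\mid X)}\,g(X,Y(a);\theta_a^*)\,g(X,Y(a);\theta_a^*)^\top\Big],$$ where the expectation that defines $\bar I_a$ exists and $J_a^{-1}\bar I_aJ_a^{-\top}$ is positive semidefinite. -/

import Mathlib

open MeasureTheory ProbabilityTheory Filter Topology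

namespace BanditInference

/-- The parameter space `ℝ^d` with its Euclidean norm. -/
abbrev Param (d : ℕ) : Type := EuclideanSpace ℝ (Fin d)

/-- One recorded round `(X_t, π_t, A_t, Y_t)`: context, realized selection probability, action,
observed outcome. -/
abbrev Obs (𝒳 : Type*) (K : ℕ) : Type _ := 𝒳 × ℝ × Fin K × ℝ

/-- The record of `T` consecutive rounds. -/
abbrev History (𝒳 : Type*) (K T : ℕ) : Type _ := Fin T → Obs 𝒳 K

/-- A behavior policy: at the round that is preceded by `t` rounds, a probability distribution on
the `K` actions for each context and each history. -/
abbrev BehaviorPolicy (𝒳 : Type*) (K : ℕ) : Type _ :=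
  (t : ℕ) → 𝒳 → History 𝒳 K t → stdSimplex ℝ (Fin K)

/-- A stationary policy. -/
abbrev StationaryPolicy (𝒳 : Type*) (K : ℕ) : Type _ := 𝒳 → stdSimplex ℝ (Fin K)

/-- The random variables of a bandit experiment. Rounds are numbered from `0`: the index `t`
stands for the round that is preceded by `t` rounds. -/
structure Experiment (Ω 𝒳 : Type*) (K : ℕ) where
  /-- the contexts -/
  X : ℕ → Ω → 𝒳
  /-- the vectors of potential outcomes -/
  Ypot : ℕ → Ω → Fin K → ℝ
  /-- the selected actions -/
  A : ℕ → Ω → Fin K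
  /-- the recorded selection probabilities of the selected actions -/
  p : ℕ → Ω → ℝ

namespace Experiment

variable {Ω 𝒳 : Type*} {K : ℕ}

/-- The observed outcome `Y_t = Y_t(A_t)`. -/
def Y (D : Experiment Ω 𝒳 K) (t : ℕ) (ω : Ω) : ℝ := D.Ypot t ω (D.A t ω)

/-- The record of the first `T` rounds. It is the dataset of size `T`, and also the history that is
available to the agent at the round of index `T`. -/
def hist (D : Experiment Ω 𝒳 K) (T : ℕ) (ω : Ω) : History 𝒳 K T :=
  fun t => (D.X t ω, D.p t ω, D.A t ω, D.Y t ω)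

/-- The σ-algebra generated by the past history and the current context. -/
@[reducible] def preActionSigma [MeasurableSpace 𝒳] (D : Experiment Ω 𝒳 K) (t : ℕ) : MeasurableSpace Ω :=
  MeasurableSpace.comap (fun ω => (D.hist t ω, D.X t ω)) inferInstance

end Experiment

/-- Conditional independence of two random variables given a σ-algebra: almost surely, the
conditional probabilities of events factorize. (No assumption on the probability space is needed
for this definition; Mathlib's `CondIndepFun`, which is equivalent to it, is restricted to standard
Borel probability spaces.) -/
def CondIndepGiven {Ω β γ : Type*} [MeasurableSpace β] [MeasurableSpace γ]
    (m : MeasurableSpace Ω) [_mΩ : MeasurableSpace Ω] (U : Ω → β) (V : Ω → γ) (μ : Measure Ω) : Prop :=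
  ∀ s t, MeasurableSet s → MeasurableSet t →
    μ⟦U ⁻¹' s ∩ V ⁻¹' t | m⟧ =ᵐ[μ] fun ω => (μ⟦U ⁻¹' s | m⟧) ω * (μ⟦V ⁻¹' t | m⟧) ω

section

variable {Ω 𝒳 : Type*} [MeasurableSpace 𝒳] {mΩ : MeasurableSpace Ω} {K d : ℕ}

/-- The data are collected sequentially by the policy `π` in a stochastic contextual bandit
environment whose contexts and potential outcomes have the joint law `P`. -/
structure IsBanditExperiment (μ : Measure Ω) (P : Measure (𝒳 × (Fin K → ℝ)))
    (π : BehaviorPolicy 𝒳 K) (D : Experiment Ω 𝒳 K) : Prop where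
  measurable_X : ∀ t, Measurable (D.X t)
  measurable_Ypot : ∀ t, Measurable (D.Ypot t)
  measurable_A : ∀ t, Measurable (D.A t)
  measurable_policy : ∀ t b, Measurable fun z : 𝒳 × History 𝒳 K t => π t z.1 z.2 b
  /-- contexts and potential outcomes are identically distributed over the rounds … -/
  law : ∀ t, μ.map (fun ω => (D.X t ω, D.Ypot t ω)) = P
  /-- … and mutually independent over the rounds … -/
  iIndep : iIndepFun (fun t ω => (D.X t ω, D.Ypot t ω)) μ
  /-- … and the environment draws those of a round independently of the history before it. -/
  indep_hist : ∀ t, IndepFun (fun ω => (D.X t ω, D.Ypot t ω)) (D.hist t) μ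
  /-- Given the history and the current context, the action is drawn from the policy. -/
  action_law : ∀ t b,
    μ⟦D.A t ⁻¹' {b} | D.preActionSigma t⟧ =ᵐ[μ] fun ω => π t (D.X t ω) (D.hist t ω) b
  /-- The recorded probability is the one with which the selected action was drawn. -/
  prob_eq : ∀ t ω, D.p t ω = π t (D.X t ω) (D.hist t ω) (D.A t ω)

/-- `A_t` is independent of the potential outcomes of round `t` given `(H_{t-1}, X_t)`. -/
def Unconfounded (μ : Measure Ω) (D : Experiment Ω 𝒳 K) : Prop :=
  ∀ t, CondIndepGiven (D.preActionSigma t) (D.A t) (D.Ypot t) μ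

/-- The selection probabilities of the action `a` converge to those of `π'` in probability. -/
def PolicyConverges (μ : Measure Ω) (π : BehaviorPolicy 𝒳 K) (D : Experiment Ω 𝒳 K)
    (π' : StationaryPolicy 𝒳 K) (a : Fin K) : Prop :=
  TendstoInMeasure μ (fun t ω => π t (D.X t ω) (D.hist t ω) a - π' (D.X t ω) a) atTop
    (fun _ => (0 : ℝ))

/-- The selection probabilities of the action `a` are bounded away from `0`. -/
def MinSamplingProb (μ : Measure Ω) (π : BehaviorPolicy 𝒳 K) (D : Experiment Ω 𝒳 K)
    (a : Fin K) : Prop :=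
  ∃ pmin ∈ Set.Ioo (0 : ℝ) 1, ∀ t, ∀ᵐ ω ∂μ, pmin ≤ π t (D.X t ω) (D.hist t ω) a

/-- The score `g(X, Y(a); θ)` at a generic observation `z = (X, Y(·))`. -/
def scoreAt (g : 𝒳 → ℝ → Param d → Param d) (a : Fin K) (θ : Param d)
    (z : 𝒳 × (Fin K → ℝ)) : Param d := g z.1 (z.2 a) θ

/-- `θ₀` solves `E[g(X, Y(a); θ)] = 0`. -/
def IsRoot (P : Measure (𝒳 × (Fin K → ℝ))) (g : 𝒳 → ℝ → Param d → Param d) (a : Fin K)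
    (θ₀ : Param d) : Prop :=
  Integrable (scoreAt g a θ₀) P ∧ ∫ z, scoreAt g a θ₀ z ∂P = 0

/-- For every `ε > 0`, the infimum of `‖E[g(X, Y(a); θ)]‖` over `‖θ - θ₀‖ > ε` is positive. -/
def WellSeparated (P : Measure (𝒳 × (Fin K → ℝ))) (g : 𝒳 → ℝ → Param d → Param d) (a : Fin K)
    (θ₀ : Param d) : Prop :=
  ∀ ε > 0, ∃ δ > 0, ∀ θ, ε < ‖θ - θ₀‖ → δ ≤ ‖∫ z, scoreAt g a θ z ∂P‖

/-- The matrix `E[g gᵀ | X]` with `g = g(X, Y(a); θ)`, as a random matrix on the space of generic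
observations. -/
noncomputable def condSecondMoment (P : Measure (𝒳 × (Fin K → ℝ)))
    (g : 𝒳 → ℝ → Param d → Param d) (a : Fin K) (θ : Param d) (z : 𝒳 × (Fin K → ℝ)) :
    Matrix (Fin d) (Fin d) ℝ :=
  Matrix.of fun i j =>
    (P[fun w => scoreAt g a θ w i * scoreAt g a θ w j |
      MeasurableSpace.comap Prod.fst inferInstance]) z

/-- The moment bounds, with `R` the radius of the ball of parameters. -/
structure BoundedMoments (P : Measure (𝒳 × (Fin K → ℝ))) (g : 𝒳 → ℝ → Param d → Param d)
    (a : Fin K) (θ₀ : Param d) (R : ℝ) : Prop where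
  /-- The norm is the spectral norm of the matrix. -/
  cond_second_moment : ∃ M₂ : ℝ, ∀ᵐ z ∂P,
    ‖Matrix.toEuclideanCLM (n := Fin d) (𝕜 := ℝ) (condSecondMoment P g a θ₀ z)‖ ≤ M₂
  root_mem : ‖θ₀‖ < R
  second_moment : ⨆ θ : Param d, ⨆ _ : ‖θ‖ ≤ R, ∫⁻ z, ‖scoreAt g a θ z‖ₑ ^ 2 ∂P < ⊤
  fourth_moment : ∫⁻ z, ‖scoreAt g a θ₀ z‖ₑ ^ 4 ∂P < ⊤

/-- The matrix `J = E[∇g(X, Y(a); θ)]`, whose `(i, j)` entry is `E[∂g⁽ⁱ⁾/∂θ_j]`. -/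
noncomputable def meanJacobian (P : Measure (𝒳 × (Fin K → ℝ))) (g : 𝒳 → ℝ → Param d → Param d)
    (a : Fin K) (θ : Param d) : Matrix (Fin d) (Fin d) ℝ :=
  Matrix.of fun i j =>
    ∫ z, (fderiv ℝ (g z.1 (z.2 a)) θ (EuclideanSpace.single j (1 : ℝ))) i ∂P

/-- Smoothness of the score in `θ`. -/
structure SmoothScore (P : Measure (𝒳 × (Fin K → ℝ))) (g : 𝒳 → ℝ → Param d → Param d)
    (a : Fin K) (θ₀ : Param d) (R : ℝ) : Prop where
  differentiable : ∀ x y, Differentiable ℝ (g x y)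
  twice_differentiable : ∀ x y, Differentiable ℝ (fderiv ℝ (g x y))
  nonsingular : IsUnit (meanJacobian P g a θ₀).det
  gradient_bound : ∃ φ : 𝒳 → ℝ → ℝ, Measurable (Function.uncurry φ) ∧
    (∀ x y θ, ‖θ‖ ≤ R → ‖fderiv ℝ (g x y) θ‖ ≤ φ x y) ∧
    Integrable (fun z => φ z.1 (z.2 a) ^ 2) P
  /-- The norm of the second derivative, a bilinear form, is the spectral norm of the Hessian. -/
  hessian_bound : ∃ ε₀ > 0, ∃ Φ : 𝒳 → ℝ → ℝ, Measurable (Function.uncurry Φ) ∧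
    (∀ x y θ, ‖θ - θ₀‖ ≤ ε₀ → ∀ i : Fin d,
      ‖fderiv ℝ (fderiv ℝ (fun θ' => g x y θ' i)) θ‖ ≤ Φ x y) ∧
    Integrable (fun z => Φ z.1 (z.2 a)) P

/-- The entries of `(1 / π'(a | X)) g gᵀ` with `g = g(X, Y(a); θ)`. -/
noncomputable def weightedOuter (g : 𝒳 → ℝ → Param d → Param d) (π' : StationaryPolicy 𝒳 K)
    (a : Fin K) (θ : Param d) (i j : Fin d) (z : 𝒳 × (Fin K → ℝ)) : ℝ :=
  1 / π' z.1 a * (scoreAt g a θ z i * scoreAt g a θ z j)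

/-- The matrix `Ī = E[(1 / π'(a | X)) g gᵀ]` with `g = g(X, Y(a); θ)`. -/
noncomputable def weightedInformation (P : Measure (𝒳 × (Fin K → ℝ)))
    (g : 𝒳 → ℝ → Param d → Param d) (π' : StationaryPolicy 𝒳 K) (a : Fin K) (θ : Param d) :
    Matrix (Fin d) (Fin d) ℝ :=
  Matrix.of fun i j => ∫ z, weightedOuter g π' a θ i j z ∂P

/-- The asymptotic covariance `J⁻¹ Ī J⁻ᵀ`. -/
noncomputable def asymptoticCov (P : Measure (𝒳 × (Fin K → ℝ)))
    (g : 𝒳 → ℝ → Param d → Param d) (π' : StationaryPolicy 𝒳 K) (a : Fin K) (θ : Param d) :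
    Matrix (Fin d) (Fin d) ℝ :=
  (meanJacobian P g a θ)⁻¹ * weightedInformation P g π' a θ *
    ((meanJacobian P g a θ)⁻¹).transpose

/-- The inverse-probability-weighted estimating function `G_T(θ)` of a dataset of `T` rounds. -/
noncomputable def ipwScore (g : 𝒳 → ℝ → Param d → Param d) (a : Fin K) {T : ℕ}
    (h : History 𝒳 K T) (θ : Param d) : Param d :=
  (T : ℝ)⁻¹ • ∑ t : Fin T,
    (1 / (h t).2.1 * (if (h t).2.2.1 = a then (1 : ℝ) else 0)) • g (h t).1 (h t).2.2.2 θ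

/-- A sequence of random vectors in the closed ball of radius `R` which solves the estimating
equation `G_T(θ̂_T) = o_p(T^{-1/2})`. -/
structure IsIPWZSequence (μ : Measure Ω) (D : Experiment Ω 𝒳 K)
    (g : 𝒳 → ℝ → Param d → Param d) (a : Fin K) (R : ℝ) (θhat : ℕ → Ω → Param d) : Prop where
  measurable : ∀ T, Measurable (θhat T)
  norm_le : ∀ T ω, ‖θhat T ω‖ ≤ R
  estimating_equation : TendstoInMeasure μ
    (fun (T : ℕ) ω => √(T : ℝ) • ipwScore g a (D.hist T ω) (θhat T ω)) atTop (fun _ => (0 : Param d))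

end

end BanditInference

open BanditInference

/-!
Inverse-probability-weighted (IPW) Z-estimation from adaptively collected bandit data.

The argument rests on one change of measure. By unconfoundedness and the law of the action, the
weight `W_t = 1{A_t = a} / π_t(A_t)` has conditional mean one given history, context and potential
outcomes, so reweighting by `W_t` leaves their joint law unchanged (`map_withDensity_ipwWeight`).
As the environment draws each round independently of the past, the centered weighted sums of a
function of `(X, Y(a))` form a martingale.

* Second moments of these sums grow linearly (`integral_sq_ipwSum_sub_le`), which gives the weak
  law of large numbers and the rate `T ^ (-1/2)`.
* The summands have conditional second moments `E[f² / π_t(a) | past]`, and these converge in `L¹`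
  to `E[f² / π̄(a)]` because the policy converges in probability and `f` has a fourth moment
  (`tendsto_integral_abs_inv_policy_sub_mul_sq`). Hence the characteristic function of the
  normalized sum satisfies, round by round, the recursion of a Gaussian random walk up to errors
  that are negligible in total (`norm_charFun_step_le`), and telescoping yields the central limit
  theorem `tendsto_integral_cexp_sqrt_mul_ipwAvg`. No conditional expectation given the past is
  needed: each identity is an expectation of a function of the past times a function of the round.

The rest is the theory of Z-estimators. The estimating functions are Lipschitz with a constant
bounded in probability, so the law of large numbers is uniform on the parameter ball and the
separation of the root gives consistency (`tendstoInMeasure_of_approximate_zero`). A Taylor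
expansion with bounded Hessian (`hasLinearization_ipwScore`) turns consistency into the
representation `√T (θ̂ - θ*) = -J⁻¹ √T G_T(θ*) + o_p(1)`, whose right-hand side is asymptotically
normal by the central limit theorem along each direction. An estimator with the required
properties is a near-minimizer of `‖G_T‖` over a countable dense subset of the ball, selected
measurably from the data; it is good enough because one Newton step from `θ*`, which the estimator
need not know, already solves the equation up to `o_p(T^{-1/2})`.
-/

namespace BanditInference

/-! ### Weighted sums and averages -/

section WeightedSums

variable {Ω 𝒳 : Type*} {K d : ℕ} {D : Experiment Ω 𝒳 K} {a : Fin K}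
  {g : 𝒳 → ℝ → Param d → Param d}

/-- The inverse-probability weight `1{A_t = a} / π_t(A_t)` of round `t`. -/
noncomputable def ipwWeight (D : Experiment Ω 𝒳 K) (a : Fin K) (t : ℕ) (ω : Ω) : ℝ :=
  1 / D.p t ω * (if D.A t ω = a then (1 : ℝ) else 0)

/-- The context and the outcome of the arm `a` of a generic observation. -/
def armEval (a : Fin K) (z : 𝒳 × (Fin K → ℝ)) : 𝒳 × ℝ := (z.1, z.2 a)

/-- The sum over the first `T` rounds of the inverse-probability-weighted values of `f`. -/
noncomputable def ipwSum (D : Experiment Ω 𝒳 K) (a : Fin K) (f : 𝒳 × ℝ → ℝ) (T : ℕ) (ω : Ω) : ℝ :=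
  ∑ t ∈ Finset.range T, ipwWeight D a t ω * f (D.X t ω, D.Ypot t ω a)

/-- The inverse-probability-weighted average of `f` over the first `T` rounds. -/
noncomputable def ipwAvg (D : Experiment Ω 𝒳 K) (a : Fin K) (f : 𝒳 × ℝ → ℝ) (T : ℕ) (ω : Ω) : ℝ :=
  (T : ℝ)⁻¹ * ipwSum D a f T ω

/-- `ipwSum` as a function of the recorded data. -/
noncomputable def histSum (a : Fin K) (f : 𝒳 × ℝ → ℝ) {T : ℕ} (h : History 𝒳 K T) : ℝ :=
  ∑ t : Fin T, (1 / (h t).2.1 * (if (h t).2.2.1 = a then (1 : ℝ) else 0)) *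
    f ((h t).1, (h t).2.2.2)

lemma histSum_hist (f : 𝒳 × ℝ → ℝ) (T : ℕ) (ω : Ω) :
    histSum a f (D.hist T ω) = ipwSum D a f T ω := by
  unfold histSum ipwSum
  rw [Finset.sum_range]
  refine Finset.sum_congr rfl fun t _ => ?_
  change 1 / D.p t ω * (if D.A t ω = a then (1 : ℝ) else 0) * f (D.X t ω, D.Ypot t ω (D.A t ω)) =
    1 / D.p t ω * (if D.A t ω = a then (1 : ℝ) else 0) * f (D.X t ω, D.Ypot t ω a)
  split_ifs with h
  · rw [h]
  · simp

lemma ipwSum_succ (f : 𝒳 × ℝ → ℝ) (T : ℕ) (ω : Ω) : ipwSum D a f (T + 1) ω =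
    ipwSum D a f T ω + ipwWeight D a T ω * f (D.X T ω, D.Ypot T ω a) :=
  Finset.sum_range_succ _ _

lemma ipwAvg_sub (f h : 𝒳 × ℝ → ℝ) (T : ℕ) (ω : Ω) :
    ipwAvg D a (fun w => f w - h w) T ω = ipwAvg D a f T ω - ipwAvg D a h T ω := by
  simp [ipwAvg, ipwSum, mul_sub, Finset.sum_sub_distrib]

lemma ipwAvg_const_mul (c : ℝ) (f : 𝒳 × ℝ → ℝ) (T : ℕ) (ω : Ω) :
    ipwAvg D a (fun w => c * f w) T ω = c * ipwAvg D a f T ω := by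
  simp only [ipwAvg, ipwSum, Finset.mul_sum]
  exact Finset.sum_congr rfl fun t _ => by ring

lemma ipwAvg_sum {ι : Type*} (s : Finset ι) (f : ι → 𝒳 × ℝ → ℝ) (T : ℕ) (ω : Ω) :
    ipwAvg D a (fun w => ∑ j ∈ s, f j w) T ω = ∑ j ∈ s, ipwAvg D a (f j) T ω := by
  simp only [ipwAvg, ipwSum, Finset.mul_sum]
  rw [Finset.sum_comm]

/-- The `i`-th coordinate of the score as a function of context and outcome. -/
def scoreCoord (g : 𝒳 → ℝ → Param d → Param d) (θ : Param d) (i : Fin d) (w : 𝒳 × ℝ) : ℝ :=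
  g w.1 w.2 θ i

lemma ipwScore_apply (T : ℕ) (ω : Ω) (θ : Param d) (i : Fin d) :
    ipwScore g a (D.hist T ω) θ i = ipwAvg D a (scoreCoord g θ i) T ω := by
  unfold ipwAvg
  rw [← histSum_hist]
  simp only [ipwScore, histSum, scoreCoord, PiLp.smul_apply, WithLp.ofLp_sum, Finset.sum_apply,
    WithLp.ofLp_smul, Pi.smul_apply, smul_eq_mul]

lemma continuous_ipwScore (hdiff : ∀ x y, Differentiable ℝ (g x y)) {T : ℕ}
    (h : History 𝒳 K T) : Continuous (ipwScore g a h) := by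
  have h1 : Continuous fun θ : Param d => ∑ t : Fin T,
      (1 / (h t).2.1 * (if (h t).2.2.1 = a then (1 : ℝ) else 0)) • g (h t).1 (h t).2.2.2 θ :=
    continuous_finsetSum _ fun t _ => by
      have := (hdiff (h t).1 (h t).2.2.2).continuous
      fun_prop
  exact h1.const_smul ((T : ℝ)⁻¹)

end WeightedSums

/-! ### Change of measure by inverse-probability weights -/

section Reweighting

variable {Ω 𝒳 : Type*} [MeasurableSpace 𝒳] {mΩ : MeasurableSpace Ω} {K d : ℕ}
  {μ : Measure Ω} {P : Measure (𝒳 × (Fin K → ℝ))} {π : BehaviorPolicy 𝒳 K}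
  {D : Experiment Ω 𝒳 K} {a : Fin K} {pmin : ℝ}

/-- Recorded probabilities are part of later histories, so that their measurability and that of the
histories are proved together by induction over the rounds. -/
lemma IsBanditExperiment.measurable_p_of_hist (hD : IsBanditExperiment μ P π D) {t : ℕ}
    (ht : Measurable (D.hist t)) : Measurable (D.p t) := by
  have h : D.p t = fun ω => ∑ b, if D.A t ω = b then π t (D.X t ω) (D.hist t ω) b else 0 := by
    funext ω
    rw [hD.prob_eq]
    simp
  rw [h]
  refine Finset.measurable_sum _ fun b _ => ?_
  refine Measurable.ite (hD.measurable_A t (measurableSet_singleton b)) ?_ measurable_const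
  exact (hD.measurable_policy t b).comp ((hD.measurable_X t).prodMk ht)

lemma IsBanditExperiment.measurable_Y (hD : IsBanditExperiment μ P π D) (t : ℕ) :
    Measurable (D.Y t) := by
  have h : D.Y t = fun ω => ∑ b, if D.A t ω = b then D.Ypot t ω b else 0 := by
    funext ω
    simp [Experiment.Y]
  rw [h]
  refine Finset.measurable_sum _ fun b _ => ?_
  exact Measurable.ite (hD.measurable_A t (measurableSet_singleton b))
    ((measurable_pi_apply b).comp (hD.measurable_Ypot t)) measurable_const

lemma IsBanditExperiment.measurable_hist (hD : IsBanditExperiment μ P π D) (t : ℕ) :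
    Measurable (D.hist t) := by
  induction t using Nat.strong_induction_on with
  | _ t ih =>
    refine measurable_pi_lambda _ fun s => ?_
    exact (hD.measurable_X s).prodMk ((hD.measurable_p_of_hist (ih s s.2)).prodMk
      ((hD.measurable_A s).prodMk (hD.measurable_Y s)))

lemma IsBanditExperiment.measurable_p (hD : IsBanditExperiment μ P π D) (t : ℕ) :
    Measurable (D.p t) :=
  hD.measurable_p_of_hist (hD.measurable_hist t)

lemma IsBanditExperiment.measurable_ipwWeight (hD : IsBanditExperiment μ P π D) (t : ℕ) :
    Measurable (ipwWeight D a t) :=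
  (measurable_const.div (hD.measurable_p t)).mul
    (Measurable.ite (hD.measurable_A t (measurableSet_singleton a)) measurable_const
      measurable_const)

lemma IsBanditExperiment.measurable_generic (hD : IsBanditExperiment μ P π D) (t : ℕ) :
    Measurable fun ω => (D.X t ω, D.Ypot t ω) :=
  (hD.measurable_X t).prodMk (hD.measurable_Ypot t)

/-- Where the weight is nonzero, the recorded probability is that of the arm `a`. -/
lemma ipwWeight_eq (hD : IsBanditExperiment μ P π D) (t : ℕ) (ω : Ω) :
    ipwWeight D a t ω =
      (π t (D.X t ω) (D.hist t ω) a)⁻¹ * (if D.A t ω = a then (1 : ℝ) else 0) := by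
  unfold ipwWeight
  rw [hD.prob_eq]
  split_ifs with h
  · rw [h, one_div]
  · simp

lemma ipwWeight_nonneg (hD : IsBanditExperiment μ P π D) (t : ℕ) (ω : Ω) :
    0 ≤ ipwWeight D a t ω := by
  rw [ipwWeight_eq hD]
  have := (π t (D.X t ω) (D.hist t ω)).2.1 a
  refine mul_nonneg (inv_nonneg.2 this) ?_
  split_ifs <;> simp

lemma ipwWeight_le (hD : IsBanditExperiment μ P π D) (hpos : 0 < pmin)
    (hmin : ∀ t, ∀ᵐ ω ∂μ, pmin ≤ π t (D.X t ω) (D.hist t ω) a) (t : ℕ) :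
    ∀ᵐ ω ∂μ, ipwWeight D a t ω ≤ pmin⁻¹ := by
  filter_upwards [hmin t] with ω hω
  rw [ipwWeight_eq hD]
  have h1 : (π t (D.X t ω) (D.hist t ω) a)⁻¹ ≤ pmin⁻¹ := inv_anti₀ hpos hω
  split_ifs
  · simpa using h1
  · simpa using hpos.le

lemma integrable_ipwWeight [IsProbabilityMeasure μ] (hD : IsBanditExperiment μ P π D)
    (hpos : 0 < pmin) (hmin : ∀ t, ∀ᵐ ω ∂μ, pmin ≤ π t (D.X t ω) (D.hist t ω) a) (t : ℕ) :
    Integrable (ipwWeight D a t) μ := by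
  refine Integrable.of_bound (hD.measurable_ipwWeight t).aestronglyMeasurable pmin⁻¹ ?_
  filter_upwards [ipwWeight_le hD hpos hmin t] with ω hω
  rwa [Real.norm_of_nonneg (ipwWeight_nonneg hD t ω)]

/-- Squaring the weight leaves one factor `1 / π_t(a)` after the change of measure; this is the
source of the weight in `Ī`. -/
lemma ipwWeight_sq (hD : IsBanditExperiment μ P π D) (t : ℕ) (ω : Ω) :
    ipwWeight D a t ω ^ 2 = ipwWeight D a t ω * (π t (D.X t ω) (D.hist t ω) a)⁻¹ := by
  rw [ipwWeight_eq hD]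
  split_ifs <;> simp [sq]

/-- The set-level form of the change of measure: on rectangles in history, context and potential
outcomes the weight `1{A_t = a} / π_t(a)` integrates to one, because its conditional mean given the
history and the context is one and the action is conditionally independent of the outcomes. -/
lemma setIntegral_ipwWeight [IsProbabilityMeasure μ] (hD : IsBanditExperiment μ P π D)
    (hunconf : Unconfounded μ D) (hpos : 0 < pmin)
    (hmin : ∀ t, ∀ᵐ ω ∂μ, pmin ≤ π t (D.X t ω) (D.hist t ω) a) (t : ℕ)
    {B : Set (History 𝒳 K t × 𝒳)} (hB : MeasurableSet B) {C : Set (Fin K → ℝ)}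
    (hC : MeasurableSet C) :
    ∫ ω in (fun ω => (D.hist t ω, D.X t ω)) ⁻¹' B ∩ D.Ypot t ⁻¹' C, ipwWeight D a t ω ∂μ =
      μ.real ((fun ω => (D.hist t ω, D.X t ω)) ⁻¹' B ∩ D.Ypot t ⁻¹' C) := by
  have hHX : Measurable (fun ω => (D.hist t ω, D.X t ω)) :=
    (hD.measurable_hist t).prodMk (hD.measurable_X t)
  have hm : D.preActionSigma t ≤ mΩ := hHX.comap_le
  have hCm : MeasurableSet (D.Ypot t ⁻¹' C) := hD.measurable_Ypot t hC
  have hAm : MeasurableSet (D.A t ⁻¹' {a}) := hD.measurable_A t (measurableSet_singleton a)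
  have hBm : MeasurableSet[D.preActionSigma t] ((fun ω => (D.hist t ω, D.X t ω)) ⁻¹' B) :=
    ⟨B, hB, rfl⟩
  set κ : Ω → ℝ := fun ω => (π t (D.X t ω) (D.hist t ω) a)⁻¹ with hκ
  have hκm : StronglyMeasurable[D.preActionSigma t] κ := by
    have h1 : Measurable fun z : History 𝒳 K t × 𝒳 => (π t z.2 z.1 a : ℝ)⁻¹ :=
      ((hD.measurable_policy t a).comp measurable_swap).inv
    exact (h1.comp (comap_measurable _)).stronglyMeasurable
  set U : Ω → ℝ := (D.A t ⁻¹' {a} ∩ D.Ypot t ⁻¹' C).indicator fun _ => 1 with hU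
  have hUint : Integrable U μ := (integrable_const _).indicator (hAm.inter hCm)
  have hκU : (κ * U) = (D.Ypot t ⁻¹' C).indicator (ipwWeight D a t) := by
    funext ω
    simp only [Pi.mul_apply, hU, hκ]
    by_cases h1 : ω ∈ D.Ypot t ⁻¹' C <;> by_cases h2 : D.A t ω = a <;>
      simp [ipwWeight_eq hD, h1, h2, Set.indicator, Set.mem_inter_iff, Set.mem_preimage] at *
  have hWint := integrable_ipwWeight hD hpos hmin t
  have hκUint : Integrable (κ * U) μ := by
    rw [hκU]
    exact hWint.indicator hCm
  have hce : μ[κ * U | D.preActionSigma t] =ᵐ[μ] μ⟦D.Ypot t ⁻¹' C | D.preActionSigma t⟧ := by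
    have h1 := condExp_mul_of_stronglyMeasurable_left hκm hκUint hUint
    have h2 := hunconf t {a} C (measurableSet_singleton a) hC
    have h3 := hD.action_law t a
    filter_upwards [h1, h2, h3, hmin t] with ω h1 h2 h3 h4
    rw [h1, Pi.mul_apply, hU, h2, h3, hκ]
    have : (π t (D.X t ω) (D.hist t ω) a : ℝ) ≠ 0 := (hpos.trans_le h4).ne'
    field_simp
  have hL : ∫ ω in (fun ω => (D.hist t ω, D.X t ω)) ⁻¹' B ∩ D.Ypot t ⁻¹' C,
      ipwWeight D a t ω ∂μ = ∫ ω in (fun ω => (D.hist t ω, D.X t ω)) ⁻¹' B, (κ * U) ω ∂μ := by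
    rw [hκU, setIntegral_indicator hCm]
  rw [hL, ← setIntegral_condExp hm hκUint hBm,
    setIntegral_congr_ae (hm _ hBm) (hce.mono fun ω h _ => h),
    setIntegral_condExp hm ((integrable_const _).indicator hCm) hBm, setIntegral_indicator hCm]
  simp

/-- Change of measure: reweighting by `1{A_t = a} / π_t(A_t)` does not change the joint law of
history, context and potential outcomes of a round. -/
lemma map_withDensity_ipwWeight [IsProbabilityMeasure μ] (hD : IsBanditExperiment μ P π D)
    (hunconf : Unconfounded μ D) (hpos : 0 < pmin)
    (hmin : ∀ t, ∀ᵐ ω ∂μ, pmin ≤ π t (D.X t ω) (D.hist t ω) a) (t : ℕ) :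
    (μ.withDensity fun ω => ENNReal.ofReal (ipwWeight D a t ω)).map
        (fun ω => ((D.hist t ω, D.X t ω), D.Ypot t ω)) =
      μ.map (fun ω => ((D.hist t ω, D.X t ω), D.Ypot t ω)) := by
  have hHX : Measurable (fun ω => (D.hist t ω, D.X t ω)) :=
    (hD.measurable_hist t).prodMk (hD.measurable_X t)
  have hm := hHX.prodMk (hD.measurable_Ypot t)
  have hWint := integrable_ipwWeight hD hpos hmin t
  have hrect : ∀ (B : Set (History 𝒳 K t × 𝒳)) (C : Set (Fin K → ℝ)), MeasurableSet B →
      MeasurableSet C →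
      (μ.withDensity fun ω => ENNReal.ofReal (ipwWeight D a t ω)).map
        (fun ω => ((D.hist t ω, D.X t ω), D.Ypot t ω)) (B ×ˢ C) =
      μ.map (fun ω => ((D.hist t ω, D.X t ω), D.Ypot t ω)) (B ×ˢ C) := by
    intro B C hB hC
    have hpre : (fun ω => ((D.hist t ω, D.X t ω), D.Ypot t ω)) ⁻¹' (B ×ˢ C) =
        (fun ω => (D.hist t ω, D.X t ω)) ⁻¹' B ∩ D.Ypot t ⁻¹' C := by
      ext ω
      simp
    have hS := (hHX hB).inter (hD.measurable_Ypot t hC)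
    rw [Measure.map_apply hm (hB.prod hC), Measure.map_apply hm (hB.prod hC), hpre,
      withDensity_apply _ hS, ← ofReal_integral_eq_lintegral_ofReal hWint.integrableOn
        (ae_of_all _ fun ω => ipwWeight_nonneg hD t ω),
      setIntegral_ipwWeight hD hunconf hpos hmin t hB hC, ofReal_measureReal]
  have : IsProbabilityMeasure (μ.map fun ω => ((D.hist t ω, D.X t ω), D.Ypot t ω)) :=
    Measure.isProbabilityMeasure_map hm.aemeasurable
  symm
  refine ext_of_generate_finite _ generateFrom_prod.symm isPiSystem_prod ?_ ?_
  · rintro _ ⟨B, hB, C, hC, rfl⟩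
    exact (hrect B C hB hC).symm
  · simpa using (hrect Set.univ Set.univ MeasurableSet.univ MeasurableSet.univ).symm

/-- The change of measure for nonnegative functions. -/
lemma lintegral_ipwWeight_mul [IsProbabilityMeasure μ] (hD : IsBanditExperiment μ P π D)
    (hunconf : Unconfounded μ D) (hpos : 0 < pmin)
    (hmin : ∀ t, ∀ᵐ ω ∂μ, pmin ≤ π t (D.X t ω) (D.hist t ω) a) (t : ℕ)
    {F : (History 𝒳 K t × 𝒳) × (Fin K → ℝ) → ENNReal} (hF : Measurable F) :
    ∫⁻ ω, ENNReal.ofReal (ipwWeight D a t ω) * F ((D.hist t ω, D.X t ω), D.Ypot t ω) ∂μ =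
      ∫⁻ ω, F ((D.hist t ω, D.X t ω), D.Ypot t ω) ∂μ := by
  have hm := ((hD.measurable_hist t).prodMk (hD.measurable_X t)).prodMk (hD.measurable_Ypot t)
  rw [← lintegral_map hF hm, ← map_withDensity_ipwWeight hD hunconf hpos hmin t,
    lintegral_map hF hm]
  exact (lintegral_withDensity_eq_lintegral_mul _
    (hD.measurable_ipwWeight t).ennreal_ofReal (hF.comp hm)).symm

/-- The change of measure for Bochner integrals. Integrability is not needed, since both sides are
integrals of `F` against the same law. -/
lemma integral_ipwWeight_mul [IsProbabilityMeasure μ] (hD : IsBanditExperiment μ P π D)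
    (hunconf : Unconfounded μ D) (hpos : 0 < pmin)
    (hmin : ∀ t, ∀ᵐ ω ∂μ, pmin ≤ π t (D.X t ω) (D.hist t ω) a) (t : ℕ)
    {E : Type*} [NormedAddCommGroup E] [NormedSpace ℝ E]
    {F : (History 𝒳 K t × 𝒳) × (Fin K → ℝ) → E} (hF : StronglyMeasurable F) :
    ∫ ω, ipwWeight D a t ω • F ((D.hist t ω, D.X t ω), D.Ypot t ω) ∂μ =
      ∫ ω, F ((D.hist t ω, D.X t ω), D.Ypot t ω) ∂μ := by
  have hm := ((hD.measurable_hist t).prodMk (hD.measurable_X t)).prodMk (hD.measurable_Ypot t)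
  rw [← integral_map hm.aemeasurable hF.aestronglyMeasurable,
    ← map_withDensity_ipwWeight hD hunconf hpos hmin t,
    integral_map hm.aemeasurable hF.aestronglyMeasurable,
    integral_withDensity_eq_integral_toReal_smul
      (hD.measurable_ipwWeight t).ennreal_ofReal (by simp)]
  simp [ENNReal.toReal_ofReal (ipwWeight_nonneg hD t _)]

end Reweighting

/-! ### Stochastic orders `o_p` and `O_p` -/

section StochasticOrder

variable {Ω E : Type*} {mΩ : MeasurableSpace Ω} {μ : Measure Ω} [SeminormedAddCommGroup E]

/-- The event `p T` has probability tending to one as `T → ∞`. It is stated through the outer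
measure of the complement, so that no measurability is required. -/
def WithHighProb (μ : Measure Ω) (p : ℕ → Ω → Prop) : Prop :=
  Tendsto (fun T => μ {ω | ¬ p T ω}) atTop (𝓝 0)

/-- The sequence `X` is bounded in probability, `X = O_p(1)`. -/
def BoundedInProb (μ : Measure Ω) (X : ℕ → Ω → ℝ) : Prop :=
  ∀ ε : ENNReal, 0 < ε → ∃ M : ℝ, ∀ᶠ T in atTop, μ {ω | ¬ |X T ω| ≤ M} ≤ ε

lemma WithHighProb.mono {p q : ℕ → Ω → Prop} (hp : WithHighProb μ p)
    (h : ∀ᶠ T in atTop, ∀ ω, p T ω → q T ω) : WithHighProb μ q := by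
  refine tendsto_of_tendsto_of_tendsto_of_le_of_le' tendsto_const_nhds hp
    (Eventually.of_forall fun _ => zero_le) ?_
  filter_upwards [h] with T hT
  exact measure_mono fun ω hω hp => hω (hT ω hp)

lemma WithHighProb.and {p q : ℕ → Ω → Prop} (hp : WithHighProb μ p) (hq : WithHighProb μ q) :
    WithHighProb μ fun T ω => p T ω ∧ q T ω := by
  have h := hp.add hq
  rw [add_zero] at h
  refine tendsto_of_tendsto_of_tendsto_of_le_of_le tendsto_const_nhds h (fun _ => zero_le)
    fun T => ?_
  refine (measure_mono fun ω hω => ?_).trans (measure_union_le _ _)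
  simp only [Set.mem_ofPred_eq, not_and_or, Set.mem_union] at hω ⊢
  exact hω

lemma withHighProb_of_ae {p : ℕ → Ω → Prop} (h : ∀ T, ∀ᵐ ω ∂μ, p T ω) : WithHighProb μ p := by
  have : (fun T => μ {ω | ¬ p T ω}) = fun _ => 0 := funext fun T => ae_iff.1 (h T)
  unfold WithHighProb
  rw [this]
  exact tendsto_const_nhds

lemma tendstoInMeasure_zero_iff {X : ℕ → Ω → E} :
    TendstoInMeasure μ X atTop (fun _ => (0 : E)) ↔
      ∀ ε > 0, WithHighProb μ fun T ω => ‖X T ω‖ < ε := by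
  simp [tendstoInMeasure_iff_norm, WithHighProb]

lemma tendstoInMeasure_zero_of_norm_le {X : ℕ → Ω → E} {Y : ℕ → Ω → ℝ}
    (hY : TendstoInMeasure μ Y atTop (fun _ => (0 : ℝ)))
    (h : WithHighProb μ fun T ω => ‖X T ω‖ ≤ Y T ω) :
    TendstoInMeasure μ X atTop (fun _ => (0 : E)) := by
  rw [tendstoInMeasure_zero_iff] at hY ⊢
  refine fun ε hε => ((hY ε hε).and h).mono (Eventually.of_forall fun T ω hω => ?_)
  exact hω.2.trans_lt ((le_abs_self _).trans_lt hω.1)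

lemma tendstoInMeasure_zero_add {X Y : ℕ → Ω → E}
    (hX : TendstoInMeasure μ X atTop (fun _ => (0 : E)))
    (hY : TendstoInMeasure μ Y atTop (fun _ => (0 : E))) :
    TendstoInMeasure μ (fun T ω => X T ω + Y T ω) atTop (fun _ => (0 : E)) := by
  rw [tendstoInMeasure_zero_iff] at *
  refine fun ε hε => ((hX (ε / 2) (half_pos hε)).and (hY (ε / 2) (half_pos hε))).mono
    (Eventually.of_forall fun T ω hω => ?_)
  linarith [norm_add_le (X T ω) (Y T ω), hω.1, hω.2]

lemma tendstoInMeasure_zero_sum {ι : Type*} (s : Finset ι) {X : ι → ℕ → Ω → E}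
    (hX : ∀ i ∈ s, TendstoInMeasure μ (X i) atTop (fun _ => (0 : E))) :
    TendstoInMeasure μ (fun T ω => ∑ i ∈ s, X i T ω) atTop (fun _ => (0 : E)) := by
  classical
  induction s using Finset.induction_on with
  | empty =>
    simp only [Finset.sum_empty]
    rw [tendstoInMeasure_zero_iff]
    exact fun ε hε => withHighProb_of_ae fun _ => ae_of_all _ fun _ => by simpa using hε
  | insert i s hi ih =>
    simp only [Finset.sum_insert hi]
    exact tendstoInMeasure_zero_add (hX i (Finset.mem_insert_self i s))
      (ih fun j hj => hX j (Finset.mem_insert_of_mem hj))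

lemma tendstoInMeasure_zero_of_tendsto {c : ℕ → ℝ} (hc : Tendsto c atTop (𝓝 0)) :
    TendstoInMeasure μ (fun T (_ : Ω) => c T) atTop (fun _ => (0 : ℝ)) := by
  rw [tendstoInMeasure_zero_iff]
  intro ε hε
  have h := hc.norm
  rw [norm_zero] at h
  exact (withHighProb_of_ae (p := fun _ _ => True) fun _ => ae_of_all _ fun _ => trivial).mono
    ((h.eventually_lt_const hε).mono fun T hT _ _ => hT)

lemma BoundedInProb.of_abs_le {X Y : ℕ → Ω → ℝ} (hY : BoundedInProb μ Y)
    (h : WithHighProb μ fun T ω => |X T ω| ≤ Y T ω) : BoundedInProb μ X := by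
  intro ε hε
  obtain ⟨M, hM⟩ := hY (ε / 2) (ENNReal.half_pos hε.ne')
  refine ⟨M, ?_⟩
  have h' := h.eventually (ge_mem_nhds (ENNReal.half_pos hε.ne'))
  filter_upwards [hM, h'] with T h1 h2
  calc μ {ω | ¬ |X T ω| ≤ M} ≤ μ ({ω | ¬ |Y T ω| ≤ M} ∪ {ω | ¬ |X T ω| ≤ Y T ω}) := by
        refine measure_mono fun ω hω => ?_
        by_contra hc
        simp only [Set.mem_union, Set.mem_ofPred_eq, not_or, not_not] at hc
        exact hω (hc.2.trans ((le_abs_self _).trans hc.1))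
    _ ≤ ε / 2 + ε / 2 := (measure_union_le _ _).trans (add_le_add h1 h2)
    _ = ε := ENNReal.add_halves ε

/-- Boundedness in probability passes to any `Z` that is bounded wherever `X` and `Y` are. -/
lemma BoundedInProb.binop {X Y Z : ℕ → Ω → ℝ} {F : ℝ → ℝ → ℝ} (hX : BoundedInProb μ X)
    (hY : BoundedInProb μ Y)
    (hZ : ∀ T ω M N, |X T ω| ≤ M → |Y T ω| ≤ N → |Z T ω| ≤ F M N) : BoundedInProb μ Z := by
  intro ε hε
  obtain ⟨M, hM⟩ := hX (ε / 2) (ENNReal.half_pos hε.ne')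
  obtain ⟨N, hN⟩ := hY (ε / 2) (ENNReal.half_pos hε.ne')
  refine ⟨F M N, ?_⟩
  filter_upwards [hM, hN] with T h1 h2
  calc μ {ω | ¬ |Z T ω| ≤ F M N} ≤ μ ({ω | ¬ |X T ω| ≤ M} ∪ {ω | ¬ |Y T ω| ≤ N}) := by
        refine measure_mono fun ω hω => ?_
        by_contra hc
        simp only [Set.mem_union, Set.mem_ofPred_eq, not_or, not_not] at hc
        exact hω (hZ T ω M N hc.1 hc.2)
    _ ≤ ε / 2 + ε / 2 := (measure_union_le _ _).trans (add_le_add h1 h2)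
    _ = ε := ENNReal.add_halves ε

lemma BoundedInProb.add {X Y : ℕ → Ω → ℝ} (hX : BoundedInProb μ X) (hY : BoundedInProb μ Y) :
    BoundedInProb μ fun T ω => X T ω + Y T ω :=
  hX.binop hY (F := fun M N => M + N) fun _ _ _ _ h1 h2 =>
    (abs_add_le _ _).trans (add_le_add h1 h2)

lemma BoundedInProb.mul {X Y : ℕ → Ω → ℝ} (hX : BoundedInProb μ X) (hY : BoundedInProb μ Y) :
    BoundedInProb μ fun T ω => X T ω * Y T ω :=
  hX.binop hY (F := fun M N => M * N) fun _ _ _ _ h1 h2 => by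
    rw [abs_mul]
    exact mul_le_mul h1 h2 (abs_nonneg _) ((abs_nonneg _).trans h1)

lemma boundedInProb_const (c : ℝ) : BoundedInProb μ fun _ _ => c :=
  fun ε _ => ⟨|c|, Eventually.of_forall fun _ => by simp⟩

lemma boundedInProb_of_tendstoInMeasure_zero {X : ℕ → Ω → ℝ}
    (hX : TendstoInMeasure μ X atTop (fun _ => (0 : ℝ))) : BoundedInProb μ X :=
  (boundedInProb_const 1).of_abs_le
    ((tendstoInMeasure_zero_iff.1 hX 1 one_pos).mono (Eventually.of_forall fun _ _ h => h.le))

lemma tendstoInMeasure_zero_mul {X Y : ℕ → Ω → ℝ}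
    (hX : TendstoInMeasure μ X atTop (fun _ => (0 : ℝ))) (hY : BoundedInProb μ Y) :
    TendstoInMeasure μ (fun T ω => X T ω * Y T ω) atTop (fun _ => (0 : ℝ)) := by
  rw [tendstoInMeasure_zero_iff] at *
  intro ε hε
  unfold WithHighProb
  rw [ENNReal.tendsto_nhds_zero]
  intro δ hδ
  obtain ⟨M, hM⟩ := hY (δ / 2) (ENNReal.half_pos hδ.ne')
  have hpos : 0 < |M| + 1 := by positivity
  have h' := (hX (ε / (|M| + 1)) (div_pos hε hpos)).eventually
    (ge_mem_nhds (ENNReal.half_pos hδ.ne'))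
  filter_upwards [hM, h'] with T h1 h2
  calc μ {ω | ¬ ‖X T ω * Y T ω‖ < ε}
      ≤ μ ({ω | ¬ |Y T ω| ≤ M} ∪ {ω | ¬ ‖X T ω‖ < ε / (|M| + 1)}) := by
        refine measure_mono fun ω hω => ?_
        by_contra hc
        simp only [Set.mem_union, Set.mem_ofPred_eq, not_or, not_not] at hc
        refine hω ?_
        rw [norm_mul, Real.norm_eq_abs (Y T ω)]
        have h3 : |Y T ω| ≤ |M| + 1 := hc.1.trans ((le_abs_self M).trans (by linarith))
        calc ‖X T ω‖ * |Y T ω| ≤ ‖X T ω‖ * (|M| + 1) := by gcongr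
          _ < ε / (|M| + 1) * (|M| + 1) := by gcongr; exact hc.2
          _ = ε := by field_simp
    _ ≤ δ / 2 + δ / 2 := (measure_union_le _ _).trans (add_le_add h1 h2)
    _ = δ := ENNReal.add_halves δ

lemma tendsto_inv_sqrt_natCast : Tendsto (fun T : ℕ => (√(T : ℝ))⁻¹) atTop (𝓝 0) :=
  tendsto_inv_atTop_zero.comp (Real.tendsto_sqrt_atTop.comp tendsto_natCast_atTop_atTop)

lemma tendstoInMeasure_zero_norm {X : ℕ → Ω → E}
    (hX : TendstoInMeasure μ X atTop (fun _ => (0 : E))) :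
    TendstoInMeasure μ (fun T ω => ‖X T ω‖) atTop (fun _ => (0 : ℝ)) := by
  rw [tendstoInMeasure_zero_iff] at *
  simpa using hX

lemma boundedInProb_sum {ι : Type*} (s : Finset ι) {X : ι → ℕ → Ω → ℝ}
    (hX : ∀ i ∈ s, BoundedInProb μ (X i)) : BoundedInProb μ fun T ω => ∑ i ∈ s, X i T ω := by
  classical
  induction s using Finset.induction_on with
  | empty => simpa using boundedInProb_const (μ := μ) 0
  | insert i s hi ih =>
    simp only [Finset.sum_insert hi]
    exact (hX i (Finset.mem_insert_self i s)).add
      (ih fun j hj => hX j (Finset.mem_insert_of_mem hj))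

lemma BoundedInProb.abs {X : ℕ → Ω → ℝ} (hX : BoundedInProb μ X) :
    BoundedInProb μ fun T ω => |X T ω| :=
  hX.binop hX (F := fun M _ => M) fun _ _ _ _ h _ => by rwa [abs_abs]

lemma tendstoInMeasure_zero_const_mul {X : ℕ → Ω → ℝ} (c : ℝ)
    (hX : TendstoInMeasure μ X atTop (fun _ => (0 : ℝ))) :
    TendstoInMeasure μ (fun T ω => c * X T ω) atTop (fun _ => (0 : ℝ)) := by
  simpa only [mul_comm] using tendstoInMeasure_zero_mul hX (boundedInProb_const c)

/-- A sequence that, for every `η > 0`, is dominated by a null sequence plus `η` times a sequence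
bounded in probability, is null. -/
lemma tendstoInMeasure_zero_of_le_add_mul {X : ℕ → Ω → E} {L : ℕ → Ω → ℝ}
    (hL : BoundedInProb μ L)
    (h : ∀ η > 0, ∃ Y : ℕ → Ω → ℝ, TendstoInMeasure μ Y atTop (fun _ => (0 : ℝ)) ∧
      WithHighProb μ fun T ω => ‖X T ω‖ ≤ Y T ω + η * L T ω) :
    TendstoInMeasure μ X atTop (fun _ => (0 : E)) := by
  rw [tendstoInMeasure_zero_iff]
  intro ε hε
  unfold WithHighProb
  rw [ENNReal.tendsto_nhds_zero]
  intro δ hδ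
  obtain ⟨M, hM⟩ := hL (δ / 2) (ENNReal.half_pos hδ.ne')
  have hpos : 0 < |M| + 1 := by positivity
  obtain ⟨Y, hY, hXY⟩ := h (ε / 2 / (|M| + 1)) (by positivity)
  have h' := ((tendstoInMeasure_zero_iff.1 hY (ε / 2) (half_pos hε)).and hXY).eventually
    (ge_mem_nhds (ENNReal.half_pos hδ.ne'))
  filter_upwards [hM, h'] with T h1 h2
  refine (measure_mono fun ω hω => ?_).trans
    (((measure_union_le _ _).trans (add_le_add h1 h2)).trans (ENNReal.add_halves δ).le)
  by_contra hc
  simp only [Set.mem_union, Set.mem_ofPred_eq, not_or, not_not] at hc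
  obtain ⟨hc1, hc2, hc3⟩ := hc
  refine hω (hc3.trans_lt ?_)
  have h3 : L T ω ≤ |M| + 1 := ((le_abs_self _).trans hc1).trans
    ((le_abs_self M).trans (by linarith))
  have h4 : ε / 2 / (|M| + 1) * L T ω ≤ ε / 2 / (|M| + 1) * (|M| + 1) := by gcongr
  rw [div_mul_cancel₀ _ hpos.ne'] at h4
  linarith [(le_abs_self _).trans_lt hc2]

/-- Markov's inequality: a sequence bounded in `L¹` is bounded in probability. -/
lemma boundedInProb_of_lintegral_le {X : ℕ → Ω → ℝ} (hX : ∀ T, AEMeasurable (X T) μ) {C : ENNReal}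
    (hC : C ≠ ⊤) (h : ∀ T, ∫⁻ ω, ‖X T ω‖ₑ ∂μ ≤ C) : BoundedInProb μ X := by
  intro ε hε
  by_cases hε' : ε = ⊤
  · exact ⟨0, Eventually.of_forall fun _ => hε' ▸ le_top⟩
  by_cases hC0 : C = 0
  · refine ⟨0, Eventually.of_forall fun T => ?_⟩
    have h0 : ∫⁻ ω, ‖X T ω‖ₑ ∂μ = 0 := le_antisymm ((h T).trans hC0.le) zero_le
    rw [lintegral_eq_zero_iff' (hX T).enorm] at h0
    have : μ {ω | ¬ |X T ω| ≤ 0} = 0 := by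
      refine ae_iff.1 (h0.mono fun ω hω => ?_)
      simpa using hω
    rw [this]
    exact zero_le
  have hCε : C / ε ≠ ⊤ := ENNReal.div_ne_top hC hε.ne'
  have hCε0 : C / ε ≠ 0 := ENNReal.div_ne_zero.2 ⟨hC0, hε'⟩
  refine ⟨(C / ε).toReal, Eventually.of_forall fun T => ?_⟩
  have hsub : {ω | ¬ |X T ω| ≤ (C / ε).toReal} ⊆ {ω | C / ε ≤ ‖X T ω‖ₑ} := by
    intro ω hω
    simp only [Set.mem_ofPred_eq, not_le] at hω ⊢
    rw [← ENNReal.ofReal_toReal hCε, ← ofReal_norm]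
    exact ENNReal.ofReal_le_ofReal hω.le
  refine (measure_mono hsub).trans ((meas_ge_le_lintegral_div (hX T).enorm hCε0 hCε).trans ?_)
  refine (ENNReal.div_le_div_right (h T) _).trans (le_of_eq ?_)
  exact ENNReal.div_div_cancel hC0 hC

end StochasticOrder

/-! ### Law of large numbers for weighted averages -/

lemma integral_add_sq {Ω : Type*} {mΩ : MeasurableSpace Ω} {μ : Measure Ω} {U V : Ω → ℝ}
    (hU : MemLp U 2 μ) (hV : MemLp V 2 μ) :
    ∫ ω, (U ω + V ω) ^ 2 ∂μ = ∫ ω, U ω ^ 2 ∂μ + 2 * ∫ ω, U ω * V ω ∂μ + ∫ ω, V ω ^ 2 ∂μ := by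
  have hUV : Integrable (fun ω => 2 * (U ω * V ω)) μ := (hU.integrable_mul hV).const_mul 2
  have h1 : Integrable (fun ω => U ω ^ 2 + 2 * (U ω * V ω)) μ := hU.integrable_sq.add hUV
  have h : ∀ ω, (U ω + V ω) ^ 2 = (U ω ^ 2 + 2 * (U ω * V ω)) + V ω ^ 2 := fun ω => by ring
  simp only [h]
  rw [integral_add h1 hV.integrable_sq, integral_add hU.integrable_sq hUV, integral_const_mul]

section Averages

variable {Ω 𝒳 : Type*} [MeasurableSpace 𝒳] {mΩ : MeasurableSpace Ω} {K d : ℕ}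
  {μ : Measure Ω} {P : Measure (𝒳 × (Fin K → ℝ))} {π : BehaviorPolicy 𝒳 K}
  {D : Experiment Ω 𝒳 K} {a : Fin K} {pmin : ℝ}

lemma measurable_armEval : Measurable (armEval a : 𝒳 × (Fin K → ℝ) → 𝒳 × ℝ) :=
  measurable_fst.prodMk ((measurable_pi_apply a).comp measurable_snd)

lemma measurable_obs_weight {T : ℕ} (t : Fin T) : Measurable fun h : History 𝒳 K T =>
    1 / (h t).2.1 * (if (h t).2.2.1 = a then (1 : ℝ) else 0) := by
  have h1 : Measurable fun h : History 𝒳 K T => h t := measurable_pi_apply t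
  have h2 : Measurable fun h : History 𝒳 K T => (h t).2.2.1 := h1.snd.snd.fst
  exact (measurable_const.div h1.snd.fst).mul
    (Measurable.ite (h2 (measurableSet_singleton a)) measurable_const measurable_const)

lemma measurable_histSum {f : 𝒳 × ℝ → ℝ} (hf : Measurable f) (T : ℕ) :
    Measurable fun h : History 𝒳 K T => histSum a f h := by
  refine Finset.measurable_sum _ fun t _ => (measurable_obs_weight t).mul ?_
  have h1 : Measurable fun h : History 𝒳 K T => h t := measurable_pi_apply t
  exact hf.comp (h1.fst.prodMk h1.snd.snd.snd)

lemma measurable_ipwSum (hD : IsBanditExperiment μ P π D) {f : 𝒳 × ℝ → ℝ} (hf : Measurable f)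
    (T : ℕ) : Measurable (ipwSum D a f T) := by
  have : ipwSum D a f T = (fun h => histSum a f h) ∘ D.hist T :=
    funext fun ω => (histSum_hist f T ω).symm
  rw [this]
  exact (measurable_histSum hf T).comp (hD.measurable_hist T)

lemma measurable_ipwAvg (hD : IsBanditExperiment μ P π D) {f : 𝒳 × ℝ → ℝ} (hf : Measurable f)
    (T : ℕ) : Measurable (ipwAvg D a f T) :=
  (measurable_ipwSum hD hf T).const_mul _

lemma lintegral_generic (hD : IsBanditExperiment μ P π D) (t : ℕ)
    {F : 𝒳 × (Fin K → ℝ) → ENNReal} (hF : Measurable F) :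
    ∫⁻ ω, F (D.X t ω, D.Ypot t ω) ∂μ = ∫⁻ z, F z ∂P := by
  rw [← hD.law t, lintegral_map hF (hD.measurable_generic t)]

lemma integral_generic (hD : IsBanditExperiment μ P π D) (t : ℕ) {F : 𝒳 × (Fin K → ℝ) → ℝ}
    (hF : Measurable F) : ∫ ω, F (D.X t ω, D.Ypot t ω) ∂μ = ∫ z, F z ∂P := by
  rw [← hD.law t, integral_map (hD.measurable_generic t).aemeasurable hF.aestronglyMeasurable]

lemma integrable_generic_iff (hD : IsBanditExperiment μ P π D) (t : ℕ) {F : 𝒳 × (Fin K → ℝ) → ℝ}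
    (hF : Measurable F) :
    Integrable (fun ω => F (D.X t ω, D.Ypot t ω)) μ ↔ Integrable F P := by
  rw [← hD.law t, integrable_map_measure hF.aestronglyMeasurable
    (hD.measurable_generic t).aemeasurable]
  rfl

lemma isProbabilityMeasure_law [IsProbabilityMeasure μ] (hD : IsBanditExperiment μ P π D) :
    IsProbabilityMeasure P := by
  rw [← hD.law 0]
  exact Measure.isProbabilityMeasure_map (hD.measurable_generic 0).aemeasurable

/-- The environment draws independently of the past: expectations of products factorize. -/
lemma integral_hist_mul_generic (hD : IsBanditExperiment μ P π D) (t : ℕ) {𝕜 : Type*} [RCLike 𝕜]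
    {ψ : History 𝒳 K t → 𝕜} (hψ : Measurable ψ) {F : 𝒳 × (Fin K → ℝ) → 𝕜} (hF : Measurable F) :
    ∫ ω, ψ (D.hist t ω) * F (D.X t ω, D.Ypot t ω) ∂μ =
      (∫ ω, ψ (D.hist t ω) ∂μ) * ∫ z, F z ∂P := by
  have hind := ((hD.indep_hist t).symm.comp hψ hF).integral_fun_mul_eq_mul_integral
    (hψ.comp (hD.measurable_hist t)).aestronglyMeasurable
    (hF.comp (hD.measurable_generic t)).aestronglyMeasurable
  rw [← hD.law t, integral_map (hD.measurable_generic t).aemeasurable hF.aestronglyMeasurable]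
  exact hind

/-- The unbiasedness of inverse-probability weighting given the past. -/
lemma integral_hist_mul_ipwWeight_mul [IsProbabilityMeasure μ] (hD : IsBanditExperiment μ P π D)
    (hunconf : Unconfounded μ D) (hpos : 0 < pmin)
    (hmin : ∀ t, ∀ᵐ ω ∂μ, pmin ≤ π t (D.X t ω) (D.hist t ω) a) (t : ℕ) {𝕜 : Type*} [RCLike 𝕜]
    {ψ : History 𝒳 K t → 𝕜} (hψ : Measurable ψ) {f : 𝒳 × ℝ → 𝕜} (hf : Measurable f) :
    ∫ ω, ψ (D.hist t ω) * ((ipwWeight D a t ω : 𝕜) * f (D.X t ω, D.Ypot t ω a)) ∂μ =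
      (∫ ω, ψ (D.hist t ω) ∂μ) * ∫ z, f (armEval a z) ∂P := by
  have hgen := integral_hist_mul_generic hD t hψ (hf.comp (measurable_armEval (a := a)))
  simp only [Function.comp_apply] at hgen
  rw [← hgen]
  have hF : Measurable fun w : (History 𝒳 K t × 𝒳) × (Fin K → ℝ) =>
      ψ w.1.1 * f (w.1.2, w.2 a) := by
    refine (hψ.comp measurable_fst.fst).mul (hf.comp ?_)
    exact measurable_fst.snd.prodMk ((measurable_pi_apply a).comp measurable_snd)
  have h := integral_ipwWeight_mul hD hunconf hpos hmin t hF.stronglyMeasurable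
  simp only [armEval] at h ⊢
  rw [← h]
  refine integral_congr_ae (ae_of_all _ fun ω => ?_)
  simp only [RCLike.real_smul_eq_coe_mul]
  ring

lemma lintegral_ipwWeight_mul_armEval [IsProbabilityMeasure μ] (hD : IsBanditExperiment μ P π D)
    (hunconf : Unconfounded μ D) (hpos : 0 < pmin)
    (hmin : ∀ t, ∀ᵐ ω ∂μ, pmin ≤ π t (D.X t ω) (D.hist t ω) a) (t : ℕ)
    {f : 𝒳 × ℝ → ENNReal} (hf : Measurable f) :
    ∫⁻ ω, ENNReal.ofReal (ipwWeight D a t ω) * f (D.X t ω, D.Ypot t ω a) ∂μ =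
      ∫⁻ z, f (armEval a z) ∂P := by
  have hF : Measurable fun w : (History 𝒳 K t × 𝒳) × (Fin K → ℝ) => f (w.1.2, w.2 a) :=
    hf.comp (measurable_fst.snd.prodMk ((measurable_pi_apply a).comp measurable_snd))
  rw [lintegral_ipwWeight_mul hD hunconf hpos hmin t hF]
  exact lintegral_generic hD t (hf.comp (measurable_armEval (a := a)))

/-- Weighted averages of an integrable function are bounded in `L¹`, hence in probability. -/
lemma boundedInProb_ipwAvg [IsProbabilityMeasure μ] (hD : IsBanditExperiment μ P π D)
    (hunconf : Unconfounded μ D) (hpos : 0 < pmin)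
    (hmin : ∀ t, ∀ᵐ ω ∂μ, pmin ≤ π t (D.X t ω) (D.hist t ω) a)
    {f : 𝒳 × ℝ → ℝ} (hf : Measurable f) (hint : Integrable (fun z => f (armEval a z)) P) :
    BoundedInProb μ (ipwAvg D a f) := by
  refine boundedInProb_of_lintegral_le (C := ∫⁻ z, ‖f (armEval a z)‖ₑ ∂P)
    (fun T => (measurable_ipwAvg hD hf T).aemeasurable) hint.2.ne fun T => ?_
  have hm : ∀ t : ℕ, Measurable fun ω =>
      ENNReal.ofReal (ipwWeight D a t ω) * ‖f (D.X t ω, D.Ypot t ω a)‖ₑ := fun t =>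
    (hD.measurable_ipwWeight t).ennreal_ofReal.mul
      (hf.comp (measurable_armEval.comp (hD.measurable_generic t))).enorm
  calc ∫⁻ ω, ‖ipwAvg D a f T ω‖ₑ ∂μ
      ≤ ∫⁻ ω, ‖(T : ℝ)⁻¹‖ₑ * ∑ t ∈ Finset.range T,
          ENNReal.ofReal (ipwWeight D a t ω) * ‖f (D.X t ω, D.Ypot t ω a)‖ₑ ∂μ := by
        refine lintegral_mono fun ω => ?_
        unfold ipwAvg ipwSum
        rw [enorm_mul]
        gcongr
        refine (enorm_sum_le _ _).trans (Finset.sum_le_sum fun t _ => ?_)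
        rw [enorm_mul, Real.enorm_of_nonneg (ipwWeight_nonneg hD t ω)]
    _ = ‖(T : ℝ)⁻¹‖ₑ * ∑ t ∈ Finset.range T, ∫⁻ z, ‖f (armEval a z)‖ₑ ∂P := by
        rw [lintegral_const_mul _ (Finset.measurable_sum _ fun t _ => hm t),
          lintegral_finsetSum _ fun t _ => hm t]
        congr 1
        refine Finset.sum_congr rfl fun t _ => ?_
        exact lintegral_ipwWeight_mul_armEval hD hunconf hpos hmin t hf.enorm
    _ ≤ ∫⁻ z, ‖f (armEval a z)‖ₑ ∂P := by
        rw [Finset.sum_const, Finset.card_range, nsmul_eq_mul, ← mul_assoc]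
        refine mul_le_of_le_one_left zero_le ?_
        rw [Real.enorm_of_nonneg (by positivity), ← ENNReal.ofReal_natCast,
          ← ENNReal.ofReal_mul (by positivity)]
        refine ENNReal.ofReal_le_one.2 ?_
        exact inv_mul_le_one

lemma memLp_ipwWeight_mul [IsProbabilityMeasure μ] (hD : IsBanditExperiment μ P π D)
    (hpos : 0 < pmin) (hmin : ∀ t, ∀ᵐ ω ∂μ, pmin ≤ π t (D.X t ω) (D.hist t ω) a) (t : ℕ)
    {f : 𝒳 × ℝ → ℝ} (hf : Measurable f) {q : ENNReal}
    (hint : MemLp (fun z => f (armEval a z)) q P) :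
    MemLp (fun ω => ipwWeight D a t ω * f (D.X t ω, D.Ypot t ω a)) q μ := by
  have h1 : MemLp (fun ω => f (D.X t ω, D.Ypot t ω a)) q μ := by
    rw [← hD.law t] at hint
    exact (memLp_map_measure_iff (hf.comp measurable_armEval).aestronglyMeasurable
      (hD.measurable_generic t).aemeasurable).1 hint
  refine h1.of_le_mul (c := pmin⁻¹) ((hD.measurable_ipwWeight t).mul
    (hf.comp (measurable_armEval.comp (hD.measurable_generic t)))).aestronglyMeasurable ?_
  filter_upwards [ipwWeight_le hD hpos hmin t] with ω hω
  rw [norm_mul, Real.norm_of_nonneg (ipwWeight_nonneg hD t ω)]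
  gcongr

lemma memLp_ipwSum [IsProbabilityMeasure μ] (hD : IsBanditExperiment μ P π D)
    (hpos : 0 < pmin) (hmin : ∀ t, ∀ᵐ ω ∂μ, pmin ≤ π t (D.X t ω) (D.hist t ω) a) (T : ℕ)
    {f : 𝒳 × ℝ → ℝ} (hf : Measurable f) {q : ENNReal}
    (hint : MemLp (fun z => f (armEval a z)) q P) :
    MemLp (ipwSum D a f T) q μ :=
  memLp_finsetSum (Finset.range T) fun t _ => memLp_ipwWeight_mul hD hpos hmin t hf hint

/-- The centered weighted sums are a martingale, so that their second moments grow linearly. -/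
lemma integral_sq_ipwSum_sub_le [IsProbabilityMeasure μ] (hD : IsBanditExperiment μ P π D)
    (hunconf : Unconfounded μ D) (hpos : 0 < pmin)
    (hmin : ∀ t, ∀ᵐ ω ∂μ, pmin ≤ π t (D.X t ω) (D.hist t ω) a)
    {f : 𝒳 × ℝ → ℝ} (hf : Measurable f) (hint : MemLp (fun z => f (armEval a z)) 2 P) (T : ℕ) :
    ∫ ω, (ipwSum D a f T ω - T * ∫ z, f (armEval a z) ∂P) ^ 2 ∂μ ≤
      T * (pmin⁻¹ * ∫ z, f (armEval a z) ^ 2 ∂P) := by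
  have hP := isProbabilityMeasure_law hD
  set m := ∫ z, f (armEval a z) ∂P with hm
  induction T with
  | zero => simp [ipwSum]
  | succ T ih =>
    have hN : MemLp (fun ω => ipwSum D a f T ω - T * m) 2 μ :=
      (memLp_ipwSum hD hpos hmin T hf hint).sub (memLp_const _)
    have hW := memLp_ipwWeight_mul hD hpos hmin T hf hint
    have hWm : MemLp (fun ω => ipwWeight D a T ω * f (D.X T ω, D.Ypot T ω a) - m) 2 μ :=
      hW.sub (memLp_const m)
    have hcross : ∫ ω, (ipwSum D a f T ω - T * m) *
        (ipwWeight D a T ω * f (D.X T ω, D.Ypot T ω a) - m) ∂μ = 0 := by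
      have h1 := integral_hist_mul_ipwWeight_mul hD hunconf hpos hmin T (𝕜 := ℝ)
        (ψ := fun h => histSum a f h - T * m) ((measurable_histSum hf T).sub_const _) hf
      simp only [histSum_hist, RCLike.ofReal_real_eq_id, id] at h1
      have hi : Integrable (fun ω => (ipwSum D a f T ω - T * m) *
          (ipwWeight D a T ω * f (D.X T ω, D.Ypot T ω a))) μ := hN.integrable_mul hW
      simp only [mul_sub _ _ m]
      rw [integral_sub hi ((hN.integrable one_le_two).mul_const m), h1,
        integral_mul_const, sub_self]
    have hmW : ∫ ω, ipwWeight D a T ω * f (D.X T ω, D.Ypot T ω a) ∂μ = m := by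
      have h1 := integral_hist_mul_ipwWeight_mul hD hunconf hpos hmin T (𝕜 := ℝ)
        (ψ := fun _ => 1) measurable_const hf
      simpa using h1
    have hsq : ∫ ω, (ipwWeight D a T ω * f (D.X T ω, D.Ypot T ω a) - m) ^ 2 ∂μ ≤
        pmin⁻¹ * ∫ z, f (armEval a z) ^ 2 ∂P := by
      simp only [sub_eq_add_neg _ m]
      rw [integral_add_sq hW (memLp_const _), integral_mul_const, hmW]
      have h2 : ∫ ω, (ipwWeight D a T ω * f (D.X T ω, D.Ypot T ω a)) ^ 2 ∂μ ≤
          ∫ ω, pmin⁻¹ * (ipwWeight D a T ω * f (D.X T ω, D.Ypot T ω a) ^ 2) ∂μ := by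
        have hfsq : MemLp (fun z => (fun w => f w ^ 2) (armEval a z)) 1 P :=
          memLp_one_iff_integrable.2 hint.integrable_sq
        refine integral_mono_ae hW.integrable_sq
          ((memLp_one_iff_integrable.1 (memLp_ipwWeight_mul hD hpos hmin T (hf.pow_const 2)
            hfsq)).const_mul _) ?_
        filter_upwards [ipwWeight_le hD hpos hmin T] with ω hω
        have := ipwWeight_nonneg (a := a) hD T ω
        simp only [mul_pow, sq (ipwWeight D a T ω)]
        rw [mul_assoc]
        gcongr
      have h3 := integral_hist_mul_ipwWeight_mul hD hunconf hpos hmin T (𝕜 := ℝ)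
        (ψ := fun _ => 1) measurable_const (hf.pow_const 2)
      simp only [one_mul, RCLike.ofReal_real_eq_id, id, integral_const, probReal_univ,
        smul_eq_mul] at h3
      rw [integral_const_mul, h3] at h2
      simp only [integral_const, probReal_univ, smul_eq_mul]
      nlinarith [sq_nonneg m]
    have hexp : ∀ ω, ipwSum D a f (T + 1) ω - (T + 1 : ℕ) * m = (ipwSum D a f T ω - T * m) +
        (ipwWeight D a T ω * f (D.X T ω, D.Ypot T ω a) - m) := fun ω => by
      rw [ipwSum_succ]
      push_cast
      ring
    simp only [hexp]
    rw [integral_add_sq hN hWm, hcross]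
    push_cast
    linarith

lemma integral_sq_ipwAvg_sub_le [IsProbabilityMeasure μ] (hD : IsBanditExperiment μ P π D)
    (hunconf : Unconfounded μ D) (hpos : 0 < pmin)
    (hmin : ∀ t, ∀ᵐ ω ∂μ, pmin ≤ π t (D.X t ω) (D.hist t ω) a)
    {f : 𝒳 × ℝ → ℝ} (hf : Measurable f) (hint : MemLp (fun z => f (armEval a z)) 2 P) (T : ℕ) :
    ∫ ω, (√T * (ipwAvg D a f T ω - ∫ z, f (armEval a z) ∂P)) ^ 2 ∂μ ≤
      pmin⁻¹ * ∫ z, f (armEval a z) ^ 2 ∂P := by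
  have hC : 0 ≤ pmin⁻¹ * ∫ z, f (armEval a z) ^ 2 ∂P :=
    mul_nonneg (inv_nonneg.2 hpos.le) (integral_nonneg fun _ => sq_nonneg _)
  rcases Nat.eq_zero_or_pos T with rfl | hT
  · simpa using hC
  have hT' : (0 : ℝ) < T := Nat.cast_pos.2 hT
  have h1 : ∀ ω, (√T * (ipwAvg D a f T ω - ∫ z, f (armEval a z) ∂P)) ^ 2 =
      (T : ℝ)⁻¹ * (ipwSum D a f T ω - T * ∫ z, f (armEval a z) ∂P) ^ 2 := fun ω => by
    rw [mul_pow, Real.sq_sqrt hT'.le, ipwAvg]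
    field_simp
  simp only [h1]
  rw [integral_const_mul, inv_mul_le_iff₀ hT']
  exact integral_sq_ipwSum_sub_le hD hunconf hpos hmin hf hint T

/-- The weighted averages estimate the mean at the rate `T ^ (-1/2)`. -/
lemma boundedInProb_sqrt_mul_ipwAvg_sub [IsProbabilityMeasure μ] (hD : IsBanditExperiment μ P π D)
    (hunconf : Unconfounded μ D) (hpos : 0 < pmin)
    (hmin : ∀ t, ∀ᵐ ω ∂μ, pmin ≤ π t (D.X t ω) (D.hist t ω) a)
    {f : 𝒳 × ℝ → ℝ} (hf : Measurable f) (hint : MemLp (fun z => f (armEval a z)) 2 P) :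
    BoundedInProb μ fun T ω => √(T : ℝ) * (ipwAvg D a f T ω - ∫ z, f (armEval a z) ∂P) := by
  have hP := isProbabilityMeasure_law hD
  have hsq : BoundedInProb μ fun T ω =>
      1 + (√(T : ℝ) * (ipwAvg D a f T ω - ∫ z, f (armEval a z) ∂P)) ^ 2 := by
    refine (boundedInProb_const 1).add (boundedInProb_of_lintegral_le
      (C := ENNReal.ofReal (pmin⁻¹ * ∫ z, f (armEval a z) ^ 2 ∂P))
      (fun T => ?_) ENNReal.ofReal_ne_top fun T => ?_)
    · exact ((((measurable_ipwAvg hD hf T).sub_const _).const_mul _).pow_const 2).aemeasurable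
    · have hmem : MemLp (fun ω => √(T : ℝ) * (ipwAvg D a f T ω - ∫ z, f (armEval a z) ∂P)) 2 μ :=
        (((memLp_ipwSum hD hpos hmin T hf hint).const_mul _).sub (memLp_const _)).const_mul _
      rw [← ofReal_integral_norm_eq_lintegral_enorm hmem.integrable_sq]
      refine ENNReal.ofReal_le_ofReal ?_
      simp only [norm_pow, Real.norm_eq_abs, sq_abs]
      exact integral_sq_ipwAvg_sub_le hD hunconf hpos hmin hf hint T
  refine hsq.of_abs_le (withHighProb_of_ae fun T => ae_of_all _ fun ω => ?_)
  generalize √(T : ℝ) * (ipwAvg D a f T ω - ∫ z, f (armEval a z) ∂P) = x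
  rw [← sq_abs]
  nlinarith [sq_nonneg (|x| - 1), abs_nonneg x]

/-- The weak law of large numbers for inverse-probability-weighted averages. -/
lemma tendstoInMeasure_ipwAvg_sub [IsProbabilityMeasure μ] (hD : IsBanditExperiment μ P π D)
    (hunconf : Unconfounded μ D) (hpos : 0 < pmin)
    (hmin : ∀ t, ∀ᵐ ω ∂μ, pmin ≤ π t (D.X t ω) (D.hist t ω) a)
    {f : 𝒳 × ℝ → ℝ} (hf : Measurable f) (hint : MemLp (fun z => f (armEval a z)) 2 P) :
    TendstoInMeasure μ (fun T ω => ipwAvg D a f T ω - ∫ z, f (armEval a z) ∂P) atTop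
      (fun _ => (0 : ℝ)) := by
  refine TendstoInMeasure.congr' ?_ (ae_eq_refl _)
    (tendstoInMeasure_zero_mul (tendstoInMeasure_zero_of_tendsto tendsto_inv_sqrt_natCast)
      (boundedInProb_sqrt_mul_ipwAvg_sub hD hunconf hpos hmin hf hint))
  filter_upwards [eventually_gt_atTop 0] with T hT
  refine ae_of_all _ fun ω => ?_
  have : √(T : ℝ) ≠ 0 := (Real.sqrt_pos.2 (Nat.cast_pos.2 hT)).ne'
  field_simp

end Averages

/-! ### Expansions of characteristic functions -/

section CharacteristicFunction

/-- The constant is not optimal: Taylor's bound serves for `|y| ≤ 1`, the triangle inequality for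
`|y| ≥ 1`. -/
lemma norm_cexp_mul_I_sub_taylor_le (y : ℝ) :
    ‖Complex.exp (y * Complex.I) - (1 + y * Complex.I - (y : ℂ) ^ 2 / 2)‖ ≤ 4 * |y| ^ 3 := by
  rcases le_total |y| 1 with h | h
  · have h1 := Complex.norm_exp_sub_sum_le_norm_mul_exp (y * Complex.I) 3
    simp only [Finset.sum_range_succ, Finset.sum_range_zero, norm_mul, Complex.norm_I,
      Complex.norm_real, mul_one, Real.norm_eq_abs] at h1
    have h2 : Complex.exp (y * Complex.I) - (1 + y * Complex.I - (y : ℂ) ^ 2 / 2) =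
        Complex.exp (y * Complex.I) - (0 + (y * Complex.I) ^ 0 / (Nat.factorial 0 : ℂ) +
          (y * Complex.I) ^ 1 / (Nat.factorial 1 : ℂ) +
          (y * Complex.I) ^ 2 / (Nat.factorial 2 : ℂ)) := by
      simp [mul_pow]
      ring
    rw [h2]
    refine h1.trans ?_
    have h3 : Real.exp |y| ≤ 4 :=
      (Real.exp_le_exp.2 h).trans (by linarith [Real.exp_one_lt_d9])
    rw [mul_comm]
    gcongr
  · have h1 : ‖Complex.exp (y * Complex.I)‖ = 1 := Complex.norm_exp_ofReal_mul_I y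
    have h2 : ‖(1 : ℂ) + y * Complex.I - (y : ℂ) ^ 2 / 2‖ ≤ 1 + |y| + |y| ^ 2 / 2 := by
      refine (norm_sub_le _ _).trans (add_le_add ((norm_add_le _ _).trans ?_) ?_)
      · simp
      · simp
    refine (norm_sub_le _ _).trans ((add_le_add h1.le h2).trans ?_)
    have h4 : |y| ≤ |y| ^ 3 := le_self_pow₀ h (by norm_num)
    have h5 : |y| ^ 2 ≤ |y| ^ 3 := pow_le_pow_right₀ h (by norm_num)
    linarith [one_le_pow₀ h (n := 3)]

lemma abs_exp_neg_sub_le {x : ℝ} (hx : 0 ≤ x) : |1 - x - Real.exp (-x)| ≤ x ^ 2 := by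
  rw [abs_sub_comm]
  rcases le_total x 1 with h | h
  · have := Real.abs_exp_sub_one_sub_id_le (x := -x) (by rwa [abs_neg, abs_of_nonneg hx])
    rw [neg_sq] at this
    convert this using 2
    ring
  · have h1 := Real.add_one_le_exp (-x)
    have h2 : Real.exp (-x) ≤ 1 := Real.exp_le_one_iff.2 (by linarith)
    rw [abs_of_nonneg (by linarith)]
    nlinarith

/-- Telescoping: a sequence that approximately solves `e (k + 1) = r * e k` with `|r| ≤ 1` stays
close to `r ^ k`. -/
lemma norm_sub_pow_le_sum {e : ℕ → ℂ} {r : ℂ} {b : ℕ → ℝ} (h0 : e 0 = 1) (hr : ‖r‖ ≤ 1)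
    (h : ∀ k, ‖e (k + 1) - r * e k‖ ≤ b k) (n : ℕ) :
    ‖e n - r ^ n‖ ≤ ∑ k ∈ Finset.range n, b k := by
  induction n with
  | zero => simp [h0]
  | succ n ih =>
    rw [Finset.sum_range_succ]
    have h1 : e (n + 1) - r ^ (n + 1) = r * (e n - r ^ n) + (e (n + 1) - r * e n) := by ring
    rw [h1]
    refine (norm_add_le _ _).trans (add_le_add ?_ (h n))
    rw [norm_mul]
    exact (mul_le_of_le_one_left (norm_nonneg _) hr).trans ih

end CharacteristicFunction

/-! ### Stabilization of the conditional variances -/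

section ConditionalVariances

variable {Ω 𝒳 : Type*} [MeasurableSpace 𝒳] {mΩ : MeasurableSpace Ω} {K d : ℕ}
  {μ : Measure Ω} {P : Measure (𝒳 × (Fin K → ℝ))} {π : BehaviorPolicy 𝒳 K}
  {D : Experiment Ω 𝒳 K} {a : Fin K} {pmin : ℝ} {πbar : StationaryPolicy 𝒳 K}

lemma stdSimplex_nonneg {K : ℕ} (p : stdSimplex ℝ (Fin K)) (b : Fin K) : 0 ≤ p b := p.2.1 b

lemma stdSimplex_le_one {K : ℕ} (p : stdSimplex ℝ (Fin K)) (b : Fin K) : p b ≤ 1 := by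
  have := Finset.single_le_sum (fun i _ => p.2.1 i) (Finset.mem_univ b)
  exact this.trans p.2.2.le

/-- The limiting policy inherits the lower bound on the selection probabilities. -/
lemma le_limitPolicy [IsProbabilityMeasure μ] (hD : IsBanditExperiment μ P π D)
    (hmin : ∀ t, ∀ᵐ ω ∂μ, pmin ≤ π t (D.X t ω) (D.hist t ω) a)
    (hπbar : ∀ b, Measurable fun x => πbar x b) (hconv : PolicyConverges μ π D πbar a) :
    ∀ᵐ z ∂P, pmin ≤ πbar z.1 a := by
  have hε : ∀ n : ℕ, ∀ᵐ z ∂P, pmin - 1 / ((n : ℝ) + 1) ≤ πbar z.1 a := by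
    intro n
    have hpos : (0 : ℝ) < 1 / ((n : ℝ) + 1) := by positivity
    have hm : MeasurableSet {z : 𝒳 × (Fin K → ℝ) | ¬ pmin - 1 / ((n : ℝ) + 1) ≤ πbar z.1 a} :=
      (measurableSet_le measurable_const ((hπbar a).comp measurable_fst)).compl
    have hle : ∀ t, P {z | ¬ pmin - 1 / ((n : ℝ) + 1) ≤ πbar z.1 a} ≤
        μ {ω | 1 / ((n : ℝ) + 1) ≤ ‖π t (D.X t ω) (D.hist t ω) a - πbar (D.X t ω) a - 0‖} := by
      intro t
      rw [← hD.law t, Measure.map_apply (hD.measurable_generic t) hm]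
      refine measure_mono_ae ?_
      filter_upwards [hmin t] with ω h1 h2
      have h3 : ¬ pmin - 1 / ((n : ℝ) + 1) ≤ πbar (D.X t ω) a := h2
      show 1 / ((n : ℝ) + 1) ≤ ‖π t (D.X t ω) (D.hist t ω) a - πbar (D.X t ω) a - 0‖
      rw [sub_zero]
      refine le_trans ?_ (le_abs_self _)
      linarith
    have hlim := (tendstoInMeasure_iff_norm.1 hconv) _ hpos
    exact le_antisymm (ge_of_tendsto' hlim hle) zero_le
  filter_upwards [ae_all_iff.2 hε] with z hz
  have h1 : Tendsto (fun n : ℕ => pmin - 1 / ((n : ℝ) + 1)) atTop (𝓝 (pmin - 0)) :=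
    tendsto_const_nhds.sub tendsto_one_div_add_atTop_nhds_zero_nat
  rw [sub_zero] at h1
  exact le_of_tendsto' h1 hz

/-- Convergence in probability of a uniformly bounded sequence gives convergence in `L²`. -/
lemma tendsto_integral_sq_of_tendstoInMeasure [IsProbabilityMeasure μ] {X : ℕ → Ω → ℝ}
    (hX : ∀ t, Measurable (X t)) (hb : ∀ t ω, |X t ω| ≤ 1)
    (h : TendstoInMeasure μ X atTop (fun _ => (0 : ℝ))) :
    Tendsto (fun t => ∫ ω, X t ω ^ 2 ∂μ) atTop (𝓝 0) := by
  rw [tendstoInMeasure_iff_measureReal_norm] at h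
  rw [Metric.tendsto_atTop]
  intro ε hε
  have hδ : 0 < ε / 3 := by positivity
  obtain ⟨N, hN⟩ := (Metric.tendsto_atTop.1 (h (min (ε / 3) 1) (by positivity))) (ε / 3) hδ
  refine ⟨N, fun t ht => ?_⟩
  have h1 := hN t ht
  rw [Real.dist_0_eq_abs, abs_of_nonneg measureReal_nonneg] at h1
  rw [Real.dist_0_eq_abs, abs_of_nonneg (integral_nonneg fun _ => sq_nonneg _)]
  have hS : MeasurableSet {ω | min (ε / 3) 1 ≤ ‖X t ω - 0‖} :=
    measurableSet_le measurable_const ((hX t).sub_const 0).norm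
  have hint : Integrable (fun ω => X t ω ^ 2) μ :=
    Integrable.of_bound ((hX t).pow_const 2).aestronglyMeasurable 1 (ae_of_all _ fun ω => by
      rw [norm_pow, Real.norm_eq_abs]
      exact pow_le_one₀ (abs_nonneg _) (hb t ω))
  calc ∫ ω, X t ω ^ 2 ∂μ
      ≤ ∫ ω, (ε / 3 + {ω | min (ε / 3) 1 ≤ ‖X t ω - 0‖}.indicator (fun _ => (1 : ℝ)) ω) ∂μ := by
        refine integral_mono hint
          ((integrable_const _).add ((integrable_const _).indicator hS)) fun ω => ?_
        by_cases hω : min (ε / 3) 1 ≤ ‖X t ω - 0‖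
        · have h2 : X t ω ^ 2 ≤ 1 := by
            rw [← sq_abs]
            exact pow_le_one₀ (abs_nonneg _) (hb t ω)
          simp only [Set.indicator, Set.mem_ofPred_eq, hω, if_true]
          linarith
        · simp only [Set.indicator, Set.mem_ofPred_eq, hω, if_false]
          rw [sub_zero, not_le, Real.norm_eq_abs] at hω
          have h3 := hω.trans_le (min_le_left _ _)
          rw [← sq_abs]
          nlinarith [abs_nonneg (X t ω), hb t ω]
    _ = ε / 3 + μ.real {ω | min (ε / 3) 1 ≤ ‖X t ω - 0‖} := by
        rw [integral_add (integrable_const _) ((integrable_const _).indicator hS),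
          integral_indicator hS]
        simp
    _ < ε := by linarith

/-- The conditional variances stabilize in `L¹`. -/
lemma tendsto_integral_abs_inv_policy_sub_mul_sq [IsProbabilityMeasure μ]
    (hD : IsBanditExperiment μ P π D) (hpos : 0 < pmin)
    (hmin : ∀ t, ∀ᵐ ω ∂μ, pmin ≤ π t (D.X t ω) (D.hist t ω) a)
    (hπbar : ∀ b, Measurable fun x => πbar x b) (hconv : PolicyConverges μ π D πbar a)
    {f : 𝒳 × ℝ → ℝ} (hf : Measurable f)
    (hint : Integrable (fun z => f (armEval a z) ^ 4) P) :
    Tendsto (fun t => ∫ ω, |(π t (D.X t ω) (D.hist t ω) a : ℝ)⁻¹ - (πbar (D.X t ω) a : ℝ)⁻¹| *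
      f (D.X t ω, D.Ypot t ω a) ^ 2 ∂μ) atTop (𝓝 0) := by
  have hΔm : ∀ t, Measurable fun ω => (π t (D.X t ω) (D.hist t ω) a : ℝ) - πbar (D.X t ω) a :=
    fun t => ((hD.measurable_policy t a).comp
      ((hD.measurable_X t).prodMk (hD.measurable_hist t))).sub ((hπbar a).comp (hD.measurable_X t))
  have hΔb : ∀ t ω, |(π t (D.X t ω) (D.hist t ω) a : ℝ) - πbar (D.X t ω) a| ≤ 1 := fun t ω => by
    rw [abs_le]
    have h1 := stdSimplex_nonneg (π t (D.X t ω) (D.hist t ω)) a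
    have h2 := stdSimplex_le_one (π t (D.X t ω) (D.hist t ω)) a
    have h3 := stdSimplex_nonneg (πbar (D.X t ω)) a
    have h4 := stdSimplex_le_one (πbar (D.X t ω)) a
    constructor <;> linarith
  have hL2 := tendsto_integral_sq_of_tendstoInMeasure hΔm hΔb hconv
  have hΔint : ∀ t, Integrable
      (fun ω => ((π t (D.X t ω) (D.hist t ω) a : ℝ) - πbar (D.X t ω) a) ^ 2) μ := fun t =>
    Integrable.of_bound ((hΔm t).pow_const 2).aestronglyMeasurable 1 (ae_of_all _ fun ω => by
      rw [norm_pow, Real.norm_eq_abs]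
      exact pow_le_one₀ (abs_nonneg _) (hΔb t ω))
  have hf4 : ∀ t, Integrable (fun ω => f (D.X t ω, D.Ypot t ω a) ^ 4) μ := fun t =>
    (integrable_generic_iff hD t ((hf.comp measurable_armEval).pow_const 4)).2 hint
  set C := ∫ z, f (armEval a z) ^ 4 ∂P with hC
  have hC0 : 0 ≤ C := integral_nonneg fun z => by positivity
  have hCeq : ∀ t, ∫ ω, f (D.X t ω, D.Ypot t ω a) ^ 4 ∂μ = C := fun t =>
    integral_generic hD t ((hf.comp (measurable_armEval (a := a))).pow_const 4)
  -- `|Δ| f² ≤ η⁻¹ Δ² + η f⁴` separates the convergence of the policy from the moments of the score.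
  have hbound : ∀ η > 0, ∀ t,
      ∫ ω, |(π t (D.X t ω) (D.hist t ω) a : ℝ)⁻¹ - (πbar (D.X t ω) a : ℝ)⁻¹| *
        f (D.X t ω, D.Ypot t ω a) ^ 2 ∂μ ≤
      (pmin⁻¹ ^ 2) * (η⁻¹ * ∫ ω, ((π t (D.X t ω) (D.hist t ω) a : ℝ) - πbar (D.X t ω) a) ^ 2 ∂μ +
        η * C) := by
    intro η hη t
    rw [← hCeq t, ← integral_const_mul, ← integral_const_mul, ← integral_add
      ((hΔint t).const_mul _) ((hf4 t).const_mul _), ← integral_const_mul]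
    refine integral_mono_of_nonneg (ae_of_all _ fun ω => by positivity)
      ((((hΔint t).const_mul _).add ((hf4 t).const_mul _)).const_mul _) ?_
    have hbar : ∀ᵐ ω ∂μ, pmin ≤ πbar (D.X t ω) a := by
      have h := le_limitPolicy hD hmin hπbar hconv
      rw [← hD.law t] at h
      exact ae_of_ae_map (hD.measurable_generic t).aemeasurable h
    filter_upwards [hmin t, hbar] with ω h1 h2
    generalize (π t (D.X t ω) (D.hist t ω) a : ℝ) = p at *
    generalize (πbar (D.X t ω) a : ℝ) = q at *
    generalize f (D.X t ω, D.Ypot t ω a) = y at *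
    have hp : 0 < p := hpos.trans_le h1
    have hq : 0 < q := hpos.trans_le h2
    have h3 : |p⁻¹ - q⁻¹| ≤ pmin⁻¹ ^ 2 * |p - q| := by
      rw [inv_sub_inv hp.ne' hq.ne', abs_div, abs_sub_comm, abs_of_pos (mul_pos hp hq),
        div_eq_mul_inv, mul_comm, mul_inv, sq]
      gcongr
    have h4 : |p - q| * y ^ 2 ≤ η⁻¹ * (p - q) ^ 2 + η * y ^ 4 := by
      rw [← sq_abs (p - q)]
      have h5 : 0 ≤ η⁻¹ * (|p - q| - η * y ^ 2) ^ 2 := by positivity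
      have h6 : η⁻¹ * (|p - q| - η * y ^ 2) ^ 2 =
          η⁻¹ * |p - q| ^ 2 - 2 * (|p - q| * y ^ 2) + η * y ^ 4 := by
        field_simp
        ring
      have h7 : 0 ≤ |p - q| * y ^ 2 := by positivity
      linarith
    calc |p⁻¹ - q⁻¹| * y ^ 2 ≤ pmin⁻¹ ^ 2 * |p - q| * y ^ 2 := by gcongr
      _ = pmin⁻¹ ^ 2 * (|p - q| * y ^ 2) := by ring
      _ ≤ pmin⁻¹ ^ 2 * (η⁻¹ * (p - q) ^ 2 + η * y ^ 4) := by gcongr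
  rw [Metric.tendsto_atTop]
  intro ε hε
  set η := ε / (2 * (pmin⁻¹ ^ 2 * (C + 1))) with hη
  have hη0 : 0 < η := by positivity
  have hlim : Tendsto (fun t => pmin⁻¹ ^ 2 *
      (η⁻¹ * ∫ ω, ((π t (D.X t ω) (D.hist t ω) a : ℝ) - πbar (D.X t ω) a) ^ 2 ∂μ + η * C)) atTop
      (𝓝 (pmin⁻¹ ^ 2 * (η⁻¹ * 0 + η * C))) :=
    ((hL2.const_mul _).add tendsto_const_nhds).const_mul _
  have hlt : pmin⁻¹ ^ 2 * (η⁻¹ * 0 + η * C) < ε := by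
    have h1 : pmin⁻¹ ^ 2 * (η⁻¹ * 0 + η * C) = ε / 2 * (C / (C + 1)) := by
      rw [hη]
      field_simp
      ring
    have h2 : C / (C + 1) ≤ 1 := (div_le_one (by positivity)).2 (by linarith)
    rw [h1]
    nlinarith
  obtain ⟨N, hN⟩ := eventually_atTop.1 (hlim.eventually_lt_const hlt)
  refine ⟨N, fun t ht => ?_⟩
  rw [Real.dist_0_eq_abs, abs_of_nonneg (integral_nonneg fun _ => by positivity)]
  exact (hbound η hη0 t).trans_lt (hN t ht)

end ConditionalVariances

/-! ### Central limit theorem for weighted averages -/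

section CentralLimit

variable {Ω 𝒳 : Type*} [MeasurableSpace 𝒳] {mΩ : MeasurableSpace Ω} {K d : ℕ}
  {μ : Measure Ω} {P : Measure (𝒳 × (Fin K → ℝ))} {π : BehaviorPolicy 𝒳 K}
  {D : Experiment Ω 𝒳 K} {a : Fin K} {pmin : ℝ} {πbar : StationaryPolicy 𝒳 K}

lemma integrable_inv_policy_mul_sq [IsProbabilityMeasure μ] (hD : IsBanditExperiment μ P π D)
    (hpos : 0 < pmin) (hmin : ∀ t, ∀ᵐ ω ∂μ, pmin ≤ π t (D.X t ω) (D.hist t ω) a)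
    {f : 𝒳 × ℝ → ℝ} (hf : Measurable f) (hint : MemLp (fun z => f (armEval a z)) 2 P) (t : ℕ) :
    Integrable (fun ω => (π t (D.X t ω) (D.hist t ω) a : ℝ)⁻¹ * f (D.X t ω, D.Ypot t ω a) ^ 2)
      μ := by
  have h1 : Integrable (fun ω => f (D.X t ω, D.Ypot t ω a) ^ 2) μ :=
    (integrable_generic_iff hD t ((hf.comp (measurable_armEval (a := a))).pow_const 2)).2
      hint.integrable_sq
  refine h1.bdd_mul (c := pmin⁻¹) (((hD.measurable_policy t a).comp
    ((hD.measurable_X t).prodMk (hD.measurable_hist t))).inv).aestronglyMeasurable ?_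
  filter_upwards [hmin t] with ω hω
  rw [norm_inv, Real.norm_of_nonneg (stdSimplex_nonneg _ a)]
  exact inv_anti₀ hpos hω

lemma integrable_inv_limitPolicy_mul [IsProbabilityMeasure μ] (hD : IsBanditExperiment μ P π D)
    (hpos : 0 < pmin) (hmin : ∀ t, ∀ᵐ ω ∂μ, pmin ≤ π t (D.X t ω) (D.hist t ω) a)
    (hπbar : ∀ b, Measurable fun x => πbar x b) (hconv : PolicyConverges μ π D πbar a)
    {F : 𝒳 × (Fin K → ℝ) → ℝ} (hint : Integrable F P) :
    Integrable (fun z => (πbar z.1 a : ℝ)⁻¹ * F z) P := by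
  refine hint.bdd_mul (c := pmin⁻¹)
    (((hπbar a).comp measurable_fst).inv).aestronglyMeasurable ?_
  filter_upwards [le_limitPolicy hD hmin hπbar hconv] with z hz
  rw [norm_inv, Real.norm_of_nonneg (stdSimplex_nonneg _ a)]
  exact inv_anti₀ hpos hz

/-- The conditional second moment of a summand differs from the limiting variance by at most the
`L¹` distance of the inverse policies, also when tested against a phase that is a function of the
past. -/
lemma norm_integral_phase_mul_sq_sub_le [IsProbabilityMeasure μ] (hD : IsBanditExperiment μ P π D)
    (hunconf : Unconfounded μ D) (hpos : 0 < pmin)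
    (hmin : ∀ t, ∀ᵐ ω ∂μ, pmin ≤ π t (D.X t ω) (D.hist t ω) a)
    (hπbar : ∀ b, Measurable fun x => πbar x b) (hconv : PolicyConverges μ π D πbar a)
    {f : 𝒳 × ℝ → ℝ} (hf : Measurable f) (hint : MemLp (fun z => f (armEval a z)) 2 P) (t : ℕ)
    {ψ : History 𝒳 K t → ℂ} (hψ : Measurable ψ) (hψ1 : ∀ h, ‖ψ h‖ ≤ 1) :
    ‖(∫ ω, ψ (D.hist t ω) *
          ((ipwWeight D a t ω * f (D.X t ω, D.Ypot t ω a) : ℝ) : ℂ) ^ 2 ∂μ) -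
        ((∫ z, (πbar z.1 a : ℝ)⁻¹ * f (armEval a z) ^ 2 ∂P : ℝ) : ℂ) *
          ∫ ω, ψ (D.hist t ω) ∂μ‖ ≤
      ∫ ω, |(π t (D.X t ω) (D.hist t ω) a : ℝ)⁻¹ - (πbar (D.X t ω) a : ℝ)⁻¹| *
        f (D.X t ω, D.Ypot t ω a) ^ 2 ∂μ := by
  have hψH : AEStronglyMeasurable (fun ω => ψ (D.hist t ω)) μ :=
    (hψ.comp (hD.measurable_hist t)).aestronglyMeasurable
  -- the first integral, by the change of measure
  have h1 : ∫ ω, ψ (D.hist t ω) *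
      ((ipwWeight D a t ω * f (D.X t ω, D.Ypot t ω a) : ℝ) : ℂ) ^ 2 ∂μ =
      ∫ ω, ψ (D.hist t ω) * (((π t (D.X t ω) (D.hist t ω) a : ℝ)⁻¹ *
        f (D.X t ω, D.Ypot t ω a) ^ 2 : ℝ) : ℂ) ∂μ := by
    have hF : Measurable fun w : (History 𝒳 K t × 𝒳) × (Fin K → ℝ) =>
        ψ w.1.1 * (((π t w.1.2 w.1.1 a : ℝ)⁻¹ * f (w.1.2, w.2 a) ^ 2 : ℝ) : ℂ) := by
      refine (hψ.comp measurable_fst.fst).mul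
        (Complex.measurable_ofReal.comp (Measurable.mul ?_ ?_))
      · exact ((hD.measurable_policy t a).comp
          (measurable_fst.snd.prodMk measurable_fst.fst)).inv
      · exact (hf.comp (measurable_fst.snd.prodMk
          ((measurable_pi_apply a).comp measurable_snd))).pow_const 2
    rw [← integral_ipwWeight_mul hD hunconf hpos hmin t hF.stronglyMeasurable]
    refine integral_congr_ae (ae_of_all _ fun ω => ?_)
    simp only [Complex.real_smul]
    rw [← Complex.ofReal_pow, mul_pow, ipwWeight_sq hD]
    push_cast
    ring
  -- the second integral, by the independence of the environment from the past
  have h2 : ((∫ z, (πbar z.1 a : ℝ)⁻¹ * f (armEval a z) ^ 2 ∂P : ℝ) : ℂ) *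
      ∫ ω, ψ (D.hist t ω) ∂μ =
      ∫ ω, ψ (D.hist t ω) * (((πbar (D.X t ω) a : ℝ)⁻¹ *
        f (D.X t ω, D.Ypot t ω a) ^ 2 : ℝ) : ℂ) ∂μ := by
    have hF : Measurable fun z : 𝒳 × (Fin K → ℝ) =>
        (((πbar z.1 a : ℝ)⁻¹ * f (armEval a z) ^ 2 : ℝ) : ℂ) :=
      Complex.measurable_ofReal.comp ((((hπbar a).comp measurable_fst).inv).mul
        ((hf.comp measurable_armEval).pow_const 2))
    rw [mul_comm, ← integral_complex_ofReal]
    exact (integral_hist_mul_generic hD t hψ hF).symm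
  have hi1 := integrable_inv_policy_mul_sq hD hpos hmin hf hint t
  have hi2 : Integrable (fun ω => (πbar (D.X t ω) a : ℝ)⁻¹ *
      f (D.X t ω, D.Ypot t ω a) ^ 2) μ :=
    (integrable_generic_iff hD t ((((hπbar a).comp measurable_fst).inv).mul
      ((hf.comp (measurable_armEval (a := a))).pow_const 2))).2
      (integrable_inv_limitPolicy_mul hD hpos hmin hπbar hconv hint.integrable_sq)
  have hc1 : Integrable (fun ω => ψ (D.hist t ω) * (((π t (D.X t ω) (D.hist t ω) a : ℝ)⁻¹ *
      f (D.X t ω, D.Ypot t ω a) ^ 2 : ℝ) : ℂ)) μ :=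
    hi1.ofReal.bdd_mul hψH (ae_of_all _ fun ω => hψ1 _)
  have hc2 : Integrable (fun ω => ψ (D.hist t ω) * (((πbar (D.X t ω) a : ℝ)⁻¹ *
      f (D.X t ω, D.Ypot t ω a) ^ 2 : ℝ) : ℂ)) μ :=
    hi2.ofReal.bdd_mul hψH (ae_of_all _ fun ω => hψ1 _)
  rw [h1, h2, ← integral_sub hc1 hc2]
  have hi3 : Integrable (fun ω =>
      |(π t (D.X t ω) (D.hist t ω) a : ℝ)⁻¹ - (πbar (D.X t ω) a : ℝ)⁻¹| *
        f (D.X t ω, D.Ypot t ω a) ^ 2) μ := by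
    refine (hi1.sub hi2).norm.congr (ae_of_all _ fun ω => ?_)
    simp only [Pi.sub_apply]
    rw [← sub_mul, norm_mul, Real.norm_eq_abs, Real.norm_of_nonneg (sq_nonneg _)]
  refine norm_integral_le_of_norm_le hi3 (ae_of_all _ fun ω => ?_)
  rw [← mul_sub, ← Complex.ofReal_sub, ← sub_mul, norm_mul, Complex.norm_real, norm_mul,
    Real.norm_eq_abs, Real.norm_of_nonneg (sq_nonneg _)]
  exact mul_le_of_le_one_left (by positivity) (hψ1 _)

lemma integral_abs_ipwWeight_mul_pow_three_le [IsProbabilityMeasure μ]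
    (hD : IsBanditExperiment μ P π D) (hpos : 0 < pmin)
    (hmin : ∀ t, ∀ᵐ ω ∂μ, pmin ≤ π t (D.X t ω) (D.hist t ω) a)
    {f : 𝒳 × ℝ → ℝ} (hf : Measurable f) (hint : MemLp (fun z => f (armEval a z)) 3 P) (t : ℕ) :
    ∫ ω, |ipwWeight D a t ω * f (D.X t ω, D.Ypot t ω a)| ^ 3 ∂μ ≤
      pmin⁻¹ ^ 3 * ∫ z, |f (armEval a z)| ^ 3 ∂P := by
  have hi : Integrable (fun z => |f (armEval a z)| ^ 3) P := by
    simpa using hint.integrable_norm_pow (p := 3) (by norm_num)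
  have hm : Measurable fun z : 𝒳 × (Fin K → ℝ) => |f (armEval a z)| ^ 3 :=
    ((hf.comp measurable_armEval).abs).pow_const 3
  rw [← integral_generic hD t hm, ← integral_const_mul]
  refine integral_mono_of_nonneg (ae_of_all _ fun ω => by positivity)
    (((integrable_generic_iff hD t hm).2 hi).const_mul _) ?_
  filter_upwards [ipwWeight_le hD hpos hmin t] with ω hω
  have h0 := ipwWeight_nonneg (a := a) hD t ω
  simp only [armEval]
  rw [abs_mul, mul_pow, abs_of_nonneg h0]
  gcongr

/-- The characteristic functions of the weighted sums satisfy, up to a small error, the recursion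
of the characteristic functions of a Gaussian random walk. -/
lemma norm_charFun_step_le [IsProbabilityMeasure μ] (hD : IsBanditExperiment μ P π D)
    (hunconf : Unconfounded μ D) (hpos : 0 < pmin)
    (hmin : ∀ t, ∀ᵐ ω ∂μ, pmin ≤ π t (D.X t ω) (D.hist t ω) a)
    (hπbar : ∀ b, Measurable fun x => πbar x b) (hconv : PolicyConverges μ π D πbar a)
    {f : 𝒳 × ℝ → ℝ} (hf : Measurable f) (hint : MemLp (fun z => f (armEval a z)) 4 P)
    (h0 : ∫ z, f (armEval a z) ∂P = 0) (s : ℝ) (t : ℕ) :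
    ‖(∫ ω, Complex.exp ((s * ipwSum D a f (t + 1) ω : ℝ) * Complex.I) ∂μ) -
        (Real.exp (-((∫ z, (πbar z.1 a : ℝ)⁻¹ * f (armEval a z) ^ 2 ∂P) * s ^ 2 / 2)) : ℝ) *
          ∫ ω, Complex.exp ((s * ipwSum D a f t ω : ℝ) * Complex.I) ∂μ‖ ≤
      4 * |s| ^ 3 * (pmin⁻¹ ^ 3 * ∫ z, |f (armEval a z)| ^ 3 ∂P) +
        s ^ 2 / 2 * (∫ ω, |(π t (D.X t ω) (D.hist t ω) a : ℝ)⁻¹ - (πbar (D.X t ω) a : ℝ)⁻¹| *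
          f (D.X t ω, D.Ypot t ω a) ^ 2 ∂μ) +
        ((∫ z, (πbar z.1 a : ℝ)⁻¹ * f (armEval a z) ^ 2 ∂P) * s ^ 2 / 2) ^ 2 := by
  have hP := isProbabilityMeasure_law hD
  set v := ∫ z, (πbar z.1 a : ℝ)⁻¹ * f (armEval a z) ^ 2 ∂P with hv
  have hv0 : 0 ≤ v := integral_nonneg fun z =>
    mul_nonneg (inv_nonneg.2 (stdSimplex_nonneg _ a)) (sq_nonneg _)
  set r := Real.exp (-(v * s ^ 2 / 2)) with hr
  have hint3 : MemLp (fun z => f (armEval a z)) 3 P := hint.mono_exponent (by norm_num)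
  have hint2 : MemLp (fun z => f (armEval a z)) 2 P := hint.mono_exponent (by norm_num)
  set x : Ω → ℝ := fun ω => ipwWeight D a t ω * f (D.X t ω, D.Ypot t ω a) with hx
  have hx3 : MemLp x 3 μ := memLp_ipwWeight_mul hD hpos hmin t hf hint3
  have hx2 : MemLp x 2 μ := hx3.mono_exponent (by norm_num)
  have hxm : Measurable x := (hD.measurable_ipwWeight t).mul
    (hf.comp ((measurable_armEval (a := a)).comp (hD.measurable_generic t)))
  set ψ : History 𝒳 K t → ℂ := fun h => Complex.exp ((s * histSum a f h : ℝ) * Complex.I) with hψ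
  have hψm : Measurable ψ := Complex.measurable_exp.comp
    ((Complex.measurable_ofReal.comp ((measurable_histSum hf t).const_mul s)).mul_const _)
  have hψ1 : ∀ h, ‖ψ h‖ ≤ 1 := fun h => (Complex.norm_exp_ofReal_mul_I _).le
  set z : Ω → ℂ := fun ω => ψ (D.hist t ω) with hz
  have hzm : AEStronglyMeasurable z μ := (hψm.comp (hD.measurable_hist t)).aestronglyMeasurable
  have hzS : ∀ ω, Complex.exp ((s * ipwSum D a f t ω : ℝ) * Complex.I) = z ω := fun ω => by
    simp only [hz, hψ, histSum_hist]
  have hz1 : ∀ᵐ ω ∂μ, ‖z ω‖ ≤ 1 := ae_of_all _ fun ω => hψ1 _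
  have hzi : Integrable z μ := Integrable.of_bound hzm 1 hz1
  have hzxi : Integrable (fun ω => z ω * (x ω : ℂ)) μ :=
    (hx2.integrable one_le_two).ofReal.bdd_mul hzm hz1
  have hzx2i : Integrable (fun ω => z ω * (x ω : ℂ) ^ 2) μ := by
    have := (hx2.integrable_sq.ofReal (𝕜 := ℂ)).bdd_mul hzm hz1
    simpa using this
  set A : Ω → ℂ := fun ω => z ω * (Complex.exp ((s * x ω : ℝ) * Complex.I) -
    (1 + (s * x ω : ℝ) * Complex.I - ((s * x ω : ℝ) : ℂ) ^ 2 / 2)) with hA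
  have hAle : ∀ ω, ‖A ω‖ ≤ 4 * |s| ^ 3 * |x ω| ^ 3 := fun ω => by
    rw [hA, norm_mul]
    refine (mul_le_of_le_one_left (norm_nonneg _) (hψ1 _)).trans ?_
    refine (norm_cexp_mul_I_sub_taylor_le (s * x ω)).trans (le_of_eq ?_)
    rw [abs_mul, mul_pow, mul_assoc]
  have hx3i : Integrable (fun ω => 4 * |s| ^ 3 * |x ω| ^ 3) μ := by
    have : Integrable (fun ω => ‖x ω‖ ^ 3) μ := hx3.integrable_norm_pow (p := 3) (by norm_num)
    exact this.const_mul _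
  have hAm : AEStronglyMeasurable A μ := by
    refine hzm.mul (Measurable.aestronglyMeasurable ?_)
    have h1 : Measurable fun ω => ((s * x ω : ℝ) : ℂ) :=
      Complex.measurable_ofReal.comp (hxm.const_mul s)
    exact (Complex.measurable_exp.comp (h1.mul_const _)).sub
      (((h1.mul_const _).const_add 1).sub ((h1.pow_const 2).div_const 2))
  have hAi : Integrable A μ := hx3i.mono' hAm (ae_of_all _ hAle)
  -- second-order expansion of the new phase `exp (i s x)`; `A` is the remainder, of order `|s x|³`
  have hexp : ∀ ω, Complex.exp ((s * ipwSum D a f (t + 1) ω : ℝ) * Complex.I) =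
      (A ω + s * Complex.I * (z ω * x ω)) +
        (-(s ^ 2 / 2 : ℂ) * (z ω * (x ω : ℂ) ^ 2) + z ω) := fun ω => by
    have h1 : ((s * ipwSum D a f (t + 1) ω : ℝ) : ℂ) * Complex.I =
        (s * ipwSum D a f t ω : ℝ) * Complex.I + (s * x ω : ℝ) * Complex.I := by
      rw [ipwSum_succ]
      push_cast [hx]
      ring
    rw [h1, Complex.exp_add, hzS]
    simp only [hA]
    push_cast
    ring
  -- the first-order term vanishes by the martingale property
  have hzx0 : ∫ ω, z ω * (x ω : ℂ) ∂μ = 0 := by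
    have h1 := integral_hist_mul_ipwWeight_mul hD hunconf hpos hmin t (𝕜 := ℂ) hψm
      (f := fun w => (f w : ℂ)) (Complex.measurable_ofReal.comp hf)
    rw [integral_complex_ofReal, h0, Complex.ofReal_zero, mul_zero] at h1
    simpa [hz, hx] using h1
  have hsq := norm_integral_phase_mul_sq_sub_le hD hunconf hpos hmin hπbar hconv hf hint2 t hψm hψ1
  rw [← hv] at hsq
  have hdecomp : (∫ ω, Complex.exp ((s * ipwSum D a f (t + 1) ω : ℝ) * Complex.I) ∂μ) -
        (r : ℂ) * ∫ ω, Complex.exp ((s * ipwSum D a f t ω : ℝ) * Complex.I) ∂μ =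
      (∫ ω, A ω ∂μ) + -(s ^ 2 / 2 : ℂ) * ((∫ ω, z ω * (x ω : ℂ) ^ 2 ∂μ) - v * ∫ ω, z ω ∂μ) +
        ((1 - v * s ^ 2 / 2 - r : ℝ) : ℂ) * ∫ ω, z ω ∂μ := by
    simp only [hexp, hzS]
    have hi1 : Integrable (fun ω => A ω + s * Complex.I * (z ω * x ω)) μ :=
      hAi.add (hzxi.const_mul _)
    have hi2 : Integrable (fun ω => -(s ^ 2 / 2 : ℂ) * (z ω * (x ω : ℂ) ^ 2) + z ω) μ :=
      (hzx2i.const_mul _).add hzi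
    rw [integral_add hi1 hi2, integral_add hAi (hzxi.const_mul _),
      integral_add (hzx2i.const_mul _) hzi, integral_const_mul, integral_const_mul, hzx0]
    push_cast
    ring
  rw [hdecomp]
  refine (norm_add_le _ _).trans (add_le_add ((norm_add_le _ _).trans (add_le_add ?_ ?_)) ?_)
  · refine (norm_integral_le_of_norm_le hx3i (ae_of_all _ hAle)).trans ?_
    rw [integral_const_mul]
    gcongr
    exact integral_abs_ipwWeight_mul_pow_three_le hD hpos hmin hf hint3 t
  · rw [norm_mul]
    have h1 : ‖-(s ^ 2 / 2 : ℂ)‖ = s ^ 2 / 2 := by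
      simp
    rw [h1]
    gcongr
  · rw [norm_mul, Complex.norm_real, Real.norm_eq_abs]
    have h1 : ‖∫ ω, z ω ∂μ‖ ≤ 1 := by
      have := norm_integral_le_of_norm_le_const hz1
      simpa using this
    exact (mul_le_of_le_one_right (abs_nonneg _) h1).trans (abs_exp_neg_sub_le (by positivity))

/-- The central limit theorem for inverse-probability-weighted averages of a centered function, in
terms of characteristic functions. -/
lemma tendsto_integral_cexp_sqrt_mul_ipwAvg [IsProbabilityMeasure μ]
    (hD : IsBanditExperiment μ P π D)
    (hunconf : Unconfounded μ D) (hpos : 0 < pmin)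
    (hmin : ∀ t, ∀ᵐ ω ∂μ, pmin ≤ π t (D.X t ω) (D.hist t ω) a)
    (hπbar : ∀ b, Measurable fun x => πbar x b) (hconv : PolicyConverges μ π D πbar a)
    {f : 𝒳 × ℝ → ℝ} (hf : Measurable f) (hint : MemLp (fun z => f (armEval a z)) 4 P)
    (h0 : ∫ z, f (armEval a z) ∂P = 0) :
    Tendsto (fun T : ℕ => ∫ ω, Complex.exp ((√T * ipwAvg D a f T ω : ℝ) * Complex.I) ∂μ) atTop
      (𝓝 (Real.exp (-((∫ z, (πbar z.1 a : ℝ)⁻¹ * f (armEval a z) ^ 2 ∂P) / 2)) : ℝ)) := by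
  have hint4 : Integrable (fun z => f (armEval a z) ^ 4) P := by
    have h1 : Integrable (fun z => ‖f (armEval a z)‖ ^ 4) P :=
      hint.integrable_norm_pow (p := 4) (by norm_num)
    refine h1.congr (ae_of_all _ fun z => ?_)
    simp only [Real.norm_eq_abs]
    exact (show Even 4 by decide).pow_abs _
  have hvar := tendsto_integral_abs_inv_policy_sub_mul_sq hD hpos hmin hπbar hconv hf hint4
  have hstep := norm_charFun_step_le hD hunconf hpos hmin hπbar hconv hf hint h0
  set v := ∫ z, (πbar z.1 a : ℝ)⁻¹ * f (armEval a z) ^ 2 ∂P with hv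
  have hv0 : 0 ≤ v := integral_nonneg fun z =>
    mul_nonneg (inv_nonneg.2 (stdSimplex_nonneg _ a)) (sq_nonneg _)
  set M := pmin⁻¹ ^ 3 * ∫ z, |f (armEval a z)| ^ 3 ∂P with hM
  set α : ℕ → ℝ := fun t => ∫ ω, |(π t (D.X t ω) (D.hist t ω) a : ℝ)⁻¹ -
    (πbar (D.X t ω) a : ℝ)⁻¹| * f (D.X t ω, D.Ypot t ω a) ^ 2 ∂μ with hα
  have hs := tendsto_inv_sqrt_natCast
  have hlim : Tendsto (fun T : ℕ => 4 * M * (√(T : ℝ))⁻¹ +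
      1 / 2 * ((T : ℝ)⁻¹ * ∑ k ∈ Finset.range T, α k) + v ^ 2 / 4 * (√(T : ℝ))⁻¹ ^ 2) atTop
      (𝓝 0) := by
    have := ((hs.const_mul (4 * M)).add ((hvar.cesaro).const_mul (1 / 2))).add
      ((hs.pow 2).const_mul (v ^ 2 / 4))
    simpa using this
  rw [tendsto_iff_norm_sub_tendsto_zero]
  refine tendsto_of_tendsto_of_tendsto_of_le_of_le' tendsto_const_nhds hlim
    (Eventually.of_forall fun _ => norm_nonneg _) ?_
  filter_upwards [eventually_gt_atTop 0] with T hT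
  have hT' : (0 : ℝ) < T := Nat.cast_pos.2 hT
  set s := (√(T : ℝ))⁻¹ with hs'
  have hs0 : 0 < s := inv_pos.2 (Real.sqrt_pos.2 hT')
  have hs2 : s ^ 2 = (T : ℝ)⁻¹ := by rw [hs', inv_pow, Real.sq_sqrt hT'.le]
  have hsT : √(T : ℝ) * (T : ℝ)⁻¹ = s := by
    rw [hs', ← div_eq_mul_inv, div_eq_iff hT'.ne', eq_comm, inv_mul_eq_iff_eq_mul₀
      (Real.sqrt_pos.2 hT').ne', Real.mul_self_sqrt hT'.le]
  have hr : ‖((Real.exp (-(v * s ^ 2 / 2)) : ℝ) : ℂ)‖ ≤ 1 := by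
    rw [Complex.norm_real, Real.norm_of_nonneg (Real.exp_pos _).le]
    exact Real.exp_le_one_iff.2 (by have : 0 ≤ v * s ^ 2 / 2 := by positivity
                                    linarith)
  have htel := norm_sub_pow_le_sum
    (e := fun t => ∫ ω, Complex.exp ((s * ipwSum D a f t ω : ℝ) * Complex.I) ∂μ)
    (by simp [ipwSum]) hr (hstep s) T
  have hpow : ((Real.exp (-(v * s ^ 2 / 2)) : ℝ) : ℂ) ^ T = (Real.exp (-(v / 2)) : ℝ) := by
    rw [← Complex.ofReal_pow, ← Real.exp_nat_mul, hs2]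
    congr 2
    field_simp
  rw [hpow] at htel
  have havg : ∀ ω, √(T : ℝ) * ipwAvg D a f T ω = s * ipwSum D a f T ω := fun ω => by
    rw [ipwAvg, ← mul_assoc, hsT]
  simp only [havg]
  refine htel.trans (le_of_eq ?_)
  rw [Finset.sum_add_distrib, Finset.sum_add_distrib, Finset.sum_const, Finset.sum_const,
    ← Finset.mul_sum, Finset.card_range, nsmul_eq_mul, nsmul_eq_mul, abs_of_pos hs0]
  have hT2 : (T : ℝ) * s ^ 2 = 1 := by rw [hs2, mul_inv_cancel₀ hT'.ne']
  rw [← hs2]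
  linear_combination (4 * M * s + v ^ 2 / 4 * s ^ 2) * hT2

end CentralLimit

/-! ### Consistency and linearization of approximate zeros -/

section ZEstimation

variable {Ω E : Type*} {mΩ : MeasurableSpace Ω} {μ : Measure Ω} [NormedAddCommGroup E]

/-- Consistency of approximate zeros: pointwise convergence of the random estimating functions
and a Lipschitz constant bounded in probability make the convergence uniform over a compact ball. -/
lemma tendstoInMeasure_of_approximate_zero [ProperSpace E] {G : ℕ → Ω → E → E} {G₀ : E → E}
    {θ₀ : E} {R C : ℝ} {L : ℕ → Ω → ℝ}
    (hG : ∀ θ, ‖θ‖ ≤ R → TendstoInMeasure μ (fun T ω => G T ω θ - G₀ θ) atTop (fun _ => (0 : E)))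
    (hL : BoundedInProb μ L)
    (hGL : ∀ T ω θ θ', ‖θ‖ ≤ R → ‖θ'‖ ≤ R → ‖G T ω θ - G T ω θ'‖ ≤ L T ω * ‖θ - θ'‖)
    (hG₀L : ∀ θ θ', ‖θ‖ ≤ R → ‖θ'‖ ≤ R → ‖G₀ θ - G₀ θ'‖ ≤ C * ‖θ - θ'‖)
    (hsep : ∀ ε > 0, ∃ δ > 0, ∀ θ, ε < ‖θ - θ₀‖ → δ ≤ ‖G₀ θ‖)
    {θhat : ℕ → Ω → E} (hR : ∀ T ω, ‖θhat T ω‖ ≤ R)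
    (hzero : TendstoInMeasure μ (fun T ω => G T ω (θhat T ω)) atTop (fun _ => (0 : E))) :
    TendstoInMeasure μ (fun T ω => θhat T ω - θ₀) atTop (fun _ => (0 : E)) := by
  have hmean : TendstoInMeasure μ (fun T ω => G₀ (θhat T ω)) atTop (fun _ => (0 : E)) := by
    refine tendstoInMeasure_zero_of_le_add_mul (L := fun T ω => |L T ω| + |C|)
      (hL.abs.add (boundedInProb_const _)) fun η hη => ?_
    obtain ⟨t, htR, htf, ht⟩ := (isCompact_closedBall (0 : E) R).finite_cover_balls hη
    lift t to Finset E using htf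
    refine ⟨fun T ω => ‖G T ω (θhat T ω)‖ + ∑ θ ∈ t, ‖G T ω θ - G₀ θ‖, ?_, ?_⟩
    · refine tendstoInMeasure_zero_add (tendstoInMeasure_zero_norm hzero)
        (tendstoInMeasure_zero_sum t fun θ hθ => tendstoInMeasure_zero_norm (hG θ ?_))
      simpa using htR hθ
    · refine withHighProb_of_ae fun T => ae_of_all _ fun ω => ?_
      have hmem : θhat T ω ∈ Metric.closedBall (0 : E) R := by simpa using hR T ω
      obtain ⟨θ, hθt, hθ⟩ := Set.mem_iUnion₂.1 (ht hmem)
      have hθR : ‖θ‖ ≤ R := by simpa using htR hθt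
      rw [Metric.mem_ball, dist_eq_norm] at hθ
      have h1 := hGL T ω (θhat T ω) θ (hR T ω) hθR
      have h2 := hG₀L (θhat T ω) θ (hR T ω) hθR
      have h3 : ‖G T ω θ - G₀ θ‖ ≤ ∑ θ ∈ t, ‖G T ω θ - G₀ θ‖ :=
        Finset.single_le_sum (f := fun θ => ‖G T ω θ - G₀ θ‖) (fun _ _ => norm_nonneg _) hθt
      have h4 : G₀ (θhat T ω) = G T ω (θhat T ω) - (G T ω (θhat T ω) - G T ω θ) -
          (G T ω θ - G₀ θ) + (G₀ (θhat T ω) - G₀ θ) := by abel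
      have h5 : L T ω * ‖θhat T ω - θ‖ ≤ |L T ω| * η :=
        mul_le_mul (le_abs_self _) hθ.le (norm_nonneg _) (abs_nonneg _)
      have h6 : C * ‖θhat T ω - θ‖ ≤ |C| * η :=
        mul_le_mul (le_abs_self _) hθ.le (norm_nonneg _) (abs_nonneg _)
      have h7 : ‖G₀ (θhat T ω)‖ ≤ ‖G T ω (θhat T ω)‖ + ‖G T ω (θhat T ω) - G T ω θ‖ +
          ‖G T ω θ - G₀ θ‖ + ‖G₀ (θhat T ω) - G₀ θ‖ := by
        conv_lhs => rw [h4]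
        refine (norm_add_le _ _).trans (add_le_add ((norm_sub_le _ _).trans
          (add_le_add (norm_sub_le _ _) le_rfl)) le_rfl)
      linarith
  rw [tendstoInMeasure_zero_iff] at *
  intro ε hε
  -- `ε / 2` because the separation of the root is assumed for strict inequalities only
  obtain ⟨δ, hδ, hsepδ⟩ := hsep (ε / 2) (half_pos hε)
  refine (hmean δ hδ).mono (Eventually.of_forall fun T ω hω => ?_)
  by_contra hc
  exact absurd (hsepδ (θhat T ω) (by linarith)) (not_le.2 hω)

variable [NormedSpace ℝ E]

/-- Undoing the scaling: `√T X_T = O_p(1)` gives `X_T = o_p(1)`. -/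
lemma tendstoInMeasure_zero_of_sqrt_smul {X : ℕ → Ω → E}
    (hX : BoundedInProb μ fun (T : ℕ) ω => ‖√(T : ℝ) • X T ω‖) :
    TendstoInMeasure μ X atTop (fun _ => (0 : E)) := by
  refine tendstoInMeasure_zero_of_norm_le (tendstoInMeasure_zero_mul
    (tendstoInMeasure_zero_of_tendsto tendsto_inv_sqrt_natCast) hX) ?_
  refine (withHighProb_of_ae (p := fun _ _ => True) fun _ => ae_of_all _ fun _ => trivial).mono ?_
  filter_upwards [eventually_gt_atTop 0] with T hT ω _
  have : 0 < √(T : ℝ) := Real.sqrt_pos.2 (Nat.cast_pos.2 hT)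
  rw [norm_smul, Real.norm_of_nonneg this.le, inv_mul_cancel_left₀ this.ne']

/-- Linearization of random estimating functions `G` at `θ₀` with derivative `J`: on a fixed
neighbourhood the error of the linear approximation is at most
`(o_p(1) + O_p(1) ‖θ - θ₀‖) ‖θ - θ₀‖`. -/
def HasLinearization (μ : Measure Ω) (G : ℕ → Ω → E → E) (θ₀ : E) (J : E →L[ℝ] E) : Prop :=
  ∃ ε₀ > 0, ∃ δ Ψ : ℕ → Ω → ℝ, TendstoInMeasure μ δ atTop (fun _ => (0 : ℝ)) ∧
    BoundedInProb μ Ψ ∧ ∀ T ω θ, ‖θ - θ₀‖ ≤ ε₀ →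
      ‖G T ω θ - G T ω θ₀ - J (θ - θ₀)‖ ≤ (δ T ω + Ψ T ω * ‖θ - θ₀‖) * ‖θ - θ₀‖

/-- For a consistent sequence the scaled linearization error is `o_p(1)` times the scaled
deviation from `θ₀`. -/
lemma HasLinearization.exists_error {G : ℕ → Ω → E → E} {θ₀ : E} {J : E →L[ℝ] E}
    (h : HasLinearization μ G θ₀ J) {θhat : ℕ → Ω → E}
    (hcons : TendstoInMeasure μ (fun T ω => θhat T ω - θ₀) atTop (fun _ => (0 : E))) :
    ∃ ρ : ℕ → Ω → ℝ, TendstoInMeasure μ ρ atTop (fun _ => (0 : ℝ)) ∧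
      WithHighProb μ fun (T : ℕ) ω => ‖√(T : ℝ) • G T ω (θhat T ω) - √(T : ℝ) • G T ω θ₀ -
        J (√(T : ℝ) • (θhat T ω - θ₀))‖ ≤ ρ T ω * ‖√(T : ℝ) • (θhat T ω - θ₀)‖ := by
  obtain ⟨ε₀, hε₀, δ, Ψ, hδ, hΨ, hlin⟩ := h
  refine ⟨fun T ω => δ T ω + ‖θhat T ω - θ₀‖ * Ψ T ω, tendstoInMeasure_zero_add hδ
    (tendstoInMeasure_zero_mul (tendstoInMeasure_zero_norm hcons) hΨ), ?_⟩
  refine (tendstoInMeasure_zero_iff.1 hcons ε₀ hε₀).mono (Eventually.of_forall fun T ω hω => ?_)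
  have h1 := hlin T ω (θhat T ω) hω.le
  rw [map_smul, ← smul_sub, ← smul_sub, norm_smul, norm_smul]
  calc ‖√(T : ℝ)‖ * ‖G T ω (θhat T ω) - G T ω θ₀ - J (θhat T ω - θ₀)‖
      ≤ ‖√(T : ℝ)‖ * ((δ T ω + Ψ T ω * ‖θhat T ω - θ₀‖) * ‖θhat T ω - θ₀‖) := by gcongr
    _ = (δ T ω + ‖θhat T ω - θ₀‖ * Ψ T ω) * (‖√(T : ℝ)‖ * ‖θhat T ω - θ₀‖) := by ring

/-- The asymptotic linear representation of consistent approximate zeros. -/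
lemma HasLinearization.tendstoInMeasure_sqrt_smul_add {G : ℕ → Ω → E → E} {θ₀ : E}
    {J Jinv : E →L[ℝ] E} (h : HasLinearization μ G θ₀ J) (hJ : ∀ v, Jinv (J v) = v)
    (hS : BoundedInProb μ fun (T : ℕ) ω => ‖√(T : ℝ) • G T ω θ₀‖) {θhat : ℕ → Ω → E}
    (hcons : TendstoInMeasure μ (fun T ω => θhat T ω - θ₀) atTop (fun _ => (0 : E)))
    (hzero : TendstoInMeasure μ (fun (T : ℕ) ω => √(T : ℝ) • G T ω (θhat T ω)) atTop
      (fun _ => (0 : E))) :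
    TendstoInMeasure μ
      (fun (T : ℕ) ω => √(T : ℝ) • (θhat T ω - θ₀) + Jinv (√(T : ℝ) • G T ω θ₀)) atTop
      (fun _ => (0 : E)) := by
  obtain ⟨ρ, hρ, hρle⟩ := h.exists_error hcons
  set c := ‖Jinv‖ with hc
  have hz := tendstoInMeasure_zero_norm hzero
  have hcρ := tendstoInMeasure_zero_iff.1 (tendstoInMeasure_zero_const_mul c hρ) (1 / 2)
    (by norm_num)
  have hΔ : BoundedInProb μ fun (T : ℕ) ω => ‖√(T : ℝ) • (θhat T ω - θ₀)‖ := by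
    refine ((boundedInProb_const (2 * c)).mul
      (hS.add (boundedInProb_of_tendstoInMeasure_zero hz))).of_abs_le ?_
    refine (hρle.and hcρ).mono (Eventually.of_forall fun T ω hω => ?_)
    obtain ⟨h1, h2⟩ := hω
    rw [abs_of_nonneg (norm_nonneg _)]
    generalize √(T : ℝ) • (θhat T ω - θ₀) = Δ at *
    generalize √(T : ℝ) • G T ω θ₀ = S at *
    generalize √(T : ℝ) • G T ω (θhat T ω) = Z at *
    have h3 : ‖Δ‖ ≤ c * ‖J Δ‖ := by
      conv_lhs => rw [← hJ Δ]
      exact Jinv.le_opNorm _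
    have h4 : ‖J Δ‖ ≤ ‖S‖ + ‖Z‖ + ρ T ω * ‖Δ‖ := by
      have h5 : J Δ = Z - S - (Z - S - J Δ) := by abel
      rw [h5]
      refine (norm_sub_le _ _).trans (add_le_add ?_ h1)
      rw [add_comm]
      exact norm_sub_le _ _
    have h6 : c * ρ T ω * ‖Δ‖ ≤ 1 / 2 * ‖Δ‖ := by
      gcongr
      exact (le_abs_self _).trans h2.le
    have h7 : c * ‖J Δ‖ ≤ c * (‖S‖ + ‖Z‖ + ρ T ω * ‖Δ‖) := by gcongr
    nlinarith
  refine tendstoInMeasure_zero_of_norm_le (tendstoInMeasure_zero_const_mul c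
    (tendstoInMeasure_zero_add hz (tendstoInMeasure_zero_mul hρ hΔ))) ?_
  refine hρle.mono (Eventually.of_forall fun T ω h1 => ?_)
  generalize √(T : ℝ) • (θhat T ω - θ₀) = Δ at *
  generalize √(T : ℝ) • G T ω θ₀ = S at *
  generalize √(T : ℝ) • G T ω (θhat T ω) = Z at *
  have h2 : Δ + Jinv S = Jinv (Z - (Z - S - J Δ)) := by
    rw [show Z - (Z - S - J Δ) = J Δ + S by abel, map_add, hJ]
  rw [h2]
  refine (Jinv.le_opNorm _).trans ?_
  gcongr
  exact (norm_sub_le _ _).trans (add_le_add le_rfl h1)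

/-- One Newton step from `θ₀` solves the estimating equation up to `o_p(T^{-1/2})`. -/
lemma HasLinearization.newton_step {G : ℕ → Ω → E → E} {θ₀ : E}
    {J Jinv : E →L[ℝ] E} (h : HasLinearization μ G θ₀ J) (hJ : ∀ v, J (Jinv v) = v)
    (hS : BoundedInProb μ fun (T : ℕ) ω => ‖√(T : ℝ) • G T ω θ₀‖) :
    TendstoInMeasure μ (fun T ω => (θ₀ - Jinv (G T ω θ₀)) - θ₀) atTop (fun _ => (0 : E)) ∧
    TendstoInMeasure μ (fun (T : ℕ) ω => √(T : ℝ) • G T ω (θ₀ - Jinv (G T ω θ₀))) atTop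
      (fun _ => (0 : E)) := by
  have hΔ : BoundedInProb μ fun (T : ℕ) ω => ‖√(T : ℝ) • ((θ₀ - Jinv (G T ω θ₀)) - θ₀)‖ := by
    refine ((boundedInProb_const ‖Jinv‖).mul hS).of_abs_le
      (withHighProb_of_ae fun T => ae_of_all _ fun ω => ?_)
    rw [sub_sub_cancel_left, smul_neg, norm_neg, abs_of_nonneg (norm_nonneg _), ← map_smul]
    exact Jinv.le_opNorm _
  have hcons := tendstoInMeasure_zero_of_sqrt_smul hΔ
  refine ⟨hcons, ?_⟩
  obtain ⟨ρ, hρ, hρle⟩ := h.exists_error hcons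
  refine tendstoInMeasure_zero_of_norm_le (tendstoInMeasure_zero_mul hρ hΔ) ?_
  refine hρle.mono (Eventually.of_forall fun T ω h1 => ?_)
  have h2 : J (√(T : ℝ) • ((θ₀ - Jinv (G T ω θ₀)) - θ₀)) = -(√(T : ℝ) • G T ω θ₀) := by
    rw [sub_sub_cancel_left, map_smul, map_neg, hJ, smul_neg]
  rw [h2] at h1
  simpa using h1

end ZEstimation

/-! ### Averages and expansions of the score -/

section EuclideanCoordinates

lemma norm_le_sum_abs {d : ℕ} (v : Param d) : ‖v‖ ≤ ∑ i, |v i| := by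
  rw [EuclideanSpace.norm_eq]
  refine Real.sqrt_le_iff.2 ⟨Finset.sum_nonneg fun _ _ => abs_nonneg _, ?_⟩
  simp only [Real.norm_eq_abs]
  exact Finset.sum_sq_le_sq_sum_of_nonneg fun _ _ => abs_nonneg _

lemma abs_coord_le_norm {d : ℕ} (v : Param d) (i : Fin d) : |v i| ≤ ‖v‖ :=
  PiLp.norm_apply_le v i

lemma continuousLinearMap_apply_coord {d : ℕ} (A : Param d →L[ℝ] Param d) (v : Param d)
    (i : Fin d) : A v i = ∑ j, v j * A (EuclideanSpace.single j (1 : ℝ)) i := by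
  have h : v = ∑ j, v j • EuclideanSpace.single j (1 : ℝ) := by
    ext k
    simp [Pi.single_apply]
  conv_lhs => rw [h]
  simp

end EuclideanCoordinates

section ScoreAverages

variable {Ω 𝒳 : Type*} [MeasurableSpace 𝒳] {mΩ : MeasurableSpace Ω} {K d : ℕ}
  {μ : Measure Ω} {P : Measure (𝒳 × (Fin K → ℝ))} {π : BehaviorPolicy 𝒳 K}
  {D : Experiment Ω 𝒳 K} {a : Fin K} {pmin : ℝ} {g : 𝒳 → ℝ → Param d → Param d}
  {θstar : Param d} {R : ℝ}

/-- The partial derivative `∂g⁽ⁱ⁾/∂θ_j` as a function of context and outcome. -/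
noncomputable def scorePartial (g : 𝒳 → ℝ → Param d → Param d) (θ : Param d) (i j : Fin d)
    (w : 𝒳 × ℝ) : ℝ :=
  (fderiv ℝ (g w.1 w.2) θ (EuclideanSpace.single j (1 : ℝ))) i

lemma abs_ipwAvg_le (hD : IsBanditExperiment μ P π D) {f F : 𝒳 × ℝ → ℝ}
    (h : ∀ w, |f w| ≤ F w) (T : ℕ) (ω : Ω) : |ipwAvg D a f T ω| ≤ ipwAvg D a F T ω := by
  unfold ipwAvg ipwSum
  rw [abs_mul, abs_of_nonneg (by positivity : (0 : ℝ) ≤ (T : ℝ)⁻¹)]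
  gcongr
  refine (Finset.abs_sum_le_sum_abs _ _).trans (Finset.sum_le_sum fun t _ => ?_)
  rw [abs_mul, abs_of_nonneg (ipwWeight_nonneg hD t ω)]
  gcongr
  · exact ipwWeight_nonneg hD t ω
  · exact h _

lemma measurable_scoreCoord (hg : ∀ θ, Measurable fun z : 𝒳 × ℝ => g z.1 z.2 θ) (θ : Param d)
    (i : Fin d) : Measurable (scoreCoord g θ i) :=
  (EuclideanSpace.proj (𝕜 := ℝ) i).continuous.measurable.comp (hg θ)

lemma measurable_scoreAt (hg : ∀ θ, Measurable fun z : 𝒳 × ℝ => g z.1 z.2 θ) (θ : Param d) :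
    Measurable (scoreAt g a θ) :=
  (hg θ).comp (measurable_armEval (a := a))

/-- A partial derivative is measurable in the observation as a limit of difference quotients. -/
lemma measurable_scorePartial (hg : ∀ θ, Measurable fun z : 𝒳 × ℝ => g z.1 z.2 θ)
    (hdiff : ∀ x y, Differentiable ℝ (g x y)) (θ : Param d) (i j : Fin d) :
    Measurable (scorePartial g θ i j) := by
  suffices h : Measurable fun w : 𝒳 × ℝ =>
      fderiv ℝ (g w.1 w.2) θ (EuclideanSpace.single j (1 : ℝ)) from
    (EuclideanSpace.proj (𝕜 := ℝ) i).continuous.measurable.comp h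
  refine measurable_of_tendsto_metrizable (f := fun (n : ℕ) (w : 𝒳 × ℝ) =>
    (n : ℝ) • (g w.1 w.2 (θ + (n : ℝ)⁻¹ • EuclideanSpace.single j (1 : ℝ)) - g w.1 w.2 θ))
    (fun n => Measurable.fun_const_smul (g := fun w : 𝒳 × ℝ =>
      g w.1 w.2 (θ + (n : ℝ)⁻¹ • EuclideanSpace.single j (1 : ℝ)) - g w.1 w.2 θ)
      ((hg _).sub (hg _)) _) (tendsto_pi_nhds.2 fun w => ?_)
  exact ((hdiff w.1 w.2 θ).hasFDerivAt.lim_real _).comp tendsto_natCast_atTop_atTop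

lemma memLp_scoreAt (hg : ∀ θ, Measurable fun z : 𝒳 × ℝ => g z.1 z.2 θ)
    (hmom : BoundedMoments P g a θstar R) {θ : Param d} (hθ : ‖θ‖ ≤ R) :
    MemLp (scoreAt g a θ) 2 P := by
  refine ⟨(measurable_scoreAt hg θ).aestronglyMeasurable, ?_⟩
  rw [eLpNorm_lt_top_iff_lintegral_rpow_enorm_lt_top (by norm_num) (by norm_num)]
  refine lt_of_le_of_lt ?_ hmom.second_moment
  refine le_trans ?_ (le_iSup₂ (f := fun (θ : Param d) (_ : ‖θ‖ ≤ R) =>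
    ∫⁻ z, ‖scoreAt g a θ z‖ₑ ^ 2 ∂P) θ hθ)
  simp

lemma memLp_four_scoreAt (hg : ∀ θ, Measurable fun z : 𝒳 × ℝ => g z.1 z.2 θ)
    (hmom : BoundedMoments P g a θstar R) : MemLp (scoreAt g a θstar) 4 P := by
  refine ⟨(measurable_scoreAt hg θstar).aestronglyMeasurable, ?_⟩
  rw [eLpNorm_lt_top_iff_lintegral_rpow_enorm_lt_top (by norm_num) (by norm_num)]
  refine lt_of_le_of_lt (le_of_eq ?_) hmom.fourth_moment
  refine lintegral_congr fun z => ?_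
  rw [← ENNReal.rpow_natCast]
  norm_num

lemma memLp_scoreCoord {θ : Param d} {q : ENNReal} (h : MemLp (scoreAt g a θ) q P) (i : Fin d) :
    MemLp (fun z => scoreCoord g θ i (armEval a z)) q P :=
  (EuclideanSpace.proj (𝕜 := ℝ) i).comp_memLp' h

lemma integral_scoreAt_apply {θ : Param d} (h : Integrable (scoreAt g a θ) P) (i : Fin d) :
    (∫ z, scoreAt g a θ z ∂P) i = ∫ z, scoreCoord g θ i (armEval a z) ∂P :=
  ((EuclideanSpace.proj (𝕜 := ℝ) i).integral_comp_comm h).symm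

/-- The weak law of large numbers for the estimating function at a fixed parameter. -/
lemma tendstoInMeasure_ipwScore_sub [IsProbabilityMeasure μ] (hD : IsBanditExperiment μ P π D)
    (hunconf : Unconfounded μ D) (hpos : 0 < pmin)
    (hmin : ∀ t, ∀ᵐ ω ∂μ, pmin ≤ π t (D.X t ω) (D.hist t ω) a)
    (hg : ∀ θ, Measurable fun z : 𝒳 × ℝ => g z.1 z.2 θ) {θ : Param d}
    (h : MemLp (scoreAt g a θ) 2 P) :
    TendstoInMeasure μ (fun T ω => ipwScore g a (D.hist T ω) θ - ∫ z, scoreAt g a θ z ∂P) atTop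
      (fun _ => (0 : Param d)) := by
  have hP := isProbabilityMeasure_law hD
  refine tendstoInMeasure_zero_of_norm_le (tendstoInMeasure_zero_sum Finset.univ fun i _ =>
    tendstoInMeasure_zero_norm (tendstoInMeasure_ipwAvg_sub hD hunconf hpos hmin
      (measurable_scoreCoord hg θ i) (memLp_scoreCoord h i)))
    (withHighProb_of_ae fun T => ae_of_all _ fun ω => (norm_le_sum_abs _).trans (le_of_eq ?_))
  refine Finset.sum_congr rfl fun i _ => ?_
  rw [PiLp.sub_apply, ipwScore_apply, integral_scoreAt_apply (h.integrable one_le_two),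
    Real.norm_eq_abs]

/-- At its root the estimating function is of order `T ^ (-1/2)`. -/
lemma boundedInProb_sqrt_smul_ipwScore [IsProbabilityMeasure μ] (hD : IsBanditExperiment μ P π D)
    (hunconf : Unconfounded μ D) (hpos : 0 < pmin)
    (hmin : ∀ t, ∀ᵐ ω ∂μ, pmin ≤ π t (D.X t ω) (D.hist t ω) a)
    (hg : ∀ θ, Measurable fun z : 𝒳 × ℝ => g z.1 z.2 θ) (hroot : IsRoot P g a θstar)
    (h : MemLp (scoreAt g a θstar) 2 P) :
    BoundedInProb μ fun (T : ℕ) ω => ‖√(T : ℝ) • ipwScore g a (D.hist T ω) θstar‖ := by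
  have hP := isProbabilityMeasure_law hD
  refine (boundedInProb_sum Finset.univ fun i _ => (boundedInProb_sqrt_mul_ipwAvg_sub hD hunconf
    hpos hmin (measurable_scoreCoord hg θstar i) (memLp_scoreCoord h i)).abs).of_abs_le
    (withHighProb_of_ae fun T => ae_of_all _ fun ω => ?_)
  rw [abs_of_nonneg (norm_nonneg _)]
  refine (norm_le_sum_abs _).trans (le_of_eq (Finset.sum_congr rfl fun i _ => ?_))
  have h0 : ∫ z, scoreCoord g θstar i (armEval a z) ∂P = 0 := by
    rw [← integral_scoreAt_apply hroot.1, hroot.2]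
    rfl
  rw [PiLp.smul_apply, ipwScore_apply, smul_eq_mul, h0, sub_zero]

end ScoreAverages

section Linearization

variable {Ω 𝒳 : Type*} [MeasurableSpace 𝒳] {mΩ : MeasurableSpace Ω} {K d : ℕ}
  {μ : Measure Ω} {P : Measure (𝒳 × (Fin K → ℝ))} {π : BehaviorPolicy 𝒳 K}
  {D : Experiment Ω 𝒳 K} {a : Fin K} {pmin : ℝ} {g : 𝒳 → ℝ → Param d → Param d}
  {θstar : Param d} {R : ℝ}

/-- First-order Taylor expansion under a bound on the second derivative in a ball. -/
lemma norm_sub_sub_fderiv_le {E : Type*} [NormedAddCommGroup E] [NormedSpace ℝ E] {h : E → ℝ}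
    (h1 : Differentiable ℝ h) (h2 : Differentiable ℝ (fderiv ℝ h)) {θ₀ : E} {ε C : ℝ}
    (hC : ∀ θ, ‖θ - θ₀‖ ≤ ε → ‖fderiv ℝ (fderiv ℝ h) θ‖ ≤ C) {θ : E} (hθ : ‖θ - θ₀‖ ≤ ε) :
    |h θ - h θ₀ - fderiv ℝ h θ₀ (θ - θ₀)| ≤ C * ‖θ - θ₀‖ ^ 2 := by
  have hmem : ∀ θ', θ' ∈ Metric.closedBall θ₀ ‖θ - θ₀‖ ↔ ‖θ' - θ₀‖ ≤ ‖θ - θ₀‖ := fun θ' => by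
    rw [Metric.mem_closedBall, dist_eq_norm]
  have h0 : θ₀ ∈ Metric.closedBall θ₀ ‖θ - θ₀‖ := (hmem θ₀).2 (by simp)
  have hconv := convex_closedBall θ₀ ‖θ - θ₀‖
  have hC0 : 0 ≤ C := (norm_nonneg (fderiv ℝ (fderiv ℝ h) θ)).trans (hC θ hθ)
  have hd : ∀ θ' ∈ Metric.closedBall θ₀ ‖θ - θ₀‖,
      ‖fderiv ℝ h θ' - fderiv ℝ h θ₀‖ ≤ C * ‖θ - θ₀‖ := fun θ' hθ' =>
    (hconv.norm_image_sub_le_of_norm_fderiv_le (fun x _ => h2 x)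
      (fun x hx => hC x (((hmem x).1 hx).trans hθ)) h0 hθ').trans
      (mul_le_mul_of_nonneg_left ((hmem θ').1 hθ') hC0)
  have := hconv.norm_image_sub_le_of_norm_fderiv_le' (fun x _ => h1 x) hd h0 ((hmem θ).2 le_rfl)
  rw [Real.norm_eq_abs] at this
  exact this.trans (le_of_eq (by ring))

/-- Averaging the Taylor expansions of the score: the empirical Jacobian converges to its mean and
the remainder is controlled by the average of the Hessian bound. -/
lemma hasLinearization_ipwScore [IsProbabilityMeasure μ] (hD : IsBanditExperiment μ P π D)
    (hunconf : Unconfounded μ D) (hpos : 0 < pmin)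
    (hmin : ∀ t, ∀ᵐ ω ∂μ, pmin ≤ π t (D.X t ω) (D.hist t ω) a)
    (hg : ∀ θ, Measurable fun z : 𝒳 × ℝ => g z.1 z.2 θ) (hR : ‖θstar‖ < R)
    (hsmooth : SmoothScore P g a θstar R) :
    HasLinearization μ (fun T ω θ => ipwScore g a (D.hist T ω) θ) θstar
      (Matrix.toEuclideanCLM (n := Fin d) (𝕜 := ℝ) (meanJacobian P g a θstar)) := by
  have hP := isProbabilityMeasure_law hD
  obtain ⟨φ, hφm, hφ, hφint⟩ := hsmooth.gradient_bound
  obtain ⟨ε₀, hε₀, Φ, hΦm, hΦ, hΦint⟩ := hsmooth.hessian_bound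
  have hpartial : ∀ i j, TendstoInMeasure μ (fun T ω => ipwAvg D a (scorePartial g θstar i j) T ω -
      meanJacobian P g a θstar i j) atTop (fun _ => (0 : ℝ)) := fun i j => by
    refine tendstoInMeasure_ipwAvg_sub hD hunconf hpos hmin
      (measurable_scorePartial hg hsmooth.differentiable θstar i j) ?_
    have hm := (measurable_scorePartial hg hsmooth.differentiable θstar i j).comp
      (measurable_armEval (a := a))
    refine (memLp_two_iff_integrable_sq hm.aestronglyMeasurable).2
      (hφint.mono' (hm.pow_const 2).aestronglyMeasurable (ae_of_all _ fun z => ?_))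
    have h1 : |scorePartial g θstar i j (armEval a z)| ≤ φ z.1 (z.2 a) := by
      refine (abs_coord_le_norm _ i).trans (((fderiv ℝ (g z.1 (z.2 a)) θstar).le_opNorm _).trans ?_)
      rw [PiLp.norm_single, norm_one, mul_one]
      exact hφ _ _ _ hR.le
    rw [Function.comp_apply, norm_pow, Real.norm_eq_abs]
    gcongr
  refine ⟨ε₀, hε₀, fun T ω => ∑ i, ∑ j, ‖ipwAvg D a (scorePartial g θstar i j) T ω -
      meanJacobian P g a θstar i j‖,
    fun T ω => ∑ _i : Fin d, ipwAvg D a (fun w => Φ w.1 w.2) T ω, ?_, ?_, ?_⟩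
  · exact tendstoInMeasure_zero_sum _ fun i _ => tendstoInMeasure_zero_sum _ fun j _ =>
      tendstoInMeasure_zero_norm (hpartial i j)
  · exact boundedInProb_sum _ fun i _ => boundedInProb_ipwAvg hD hunconf hpos hmin hΦm hΦint
  · intro T ω θ hθ
    refine (norm_le_sum_abs _).trans ?_
    rw [add_mul, Finset.sum_mul, Finset.sum_mul, Finset.sum_mul, ← Finset.sum_add_distrib]
    refine Finset.sum_le_sum fun i _ => ?_
    set v := θ - θstar with hv
    -- the `i`-th coordinate splits into the averaged Taylor remainder and the Jacobian error
    have hrem : |ipwAvg D a (fun w => scoreCoord g θ i w - scoreCoord g θstar i w -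
        ∑ j, v j * scorePartial g θstar i j w) T ω| ≤
        ipwAvg D a (fun w => ‖v‖ ^ 2 * Φ w.1 w.2) T ω := by
      refine abs_ipwAvg_le hD (fun w => ?_) T ω
      have hcoord : ∀ θ', HasFDerivAt (fun θ' => g w.1 w.2 θ' i)
          ((EuclideanSpace.proj (𝕜 := ℝ) i).comp (fderiv ℝ (g w.1 w.2) θ')) θ' := fun θ' =>
        (EuclideanSpace.proj (𝕜 := ℝ) i).hasFDerivAt.comp θ'
          (hsmooth.differentiable w.1 w.2 θ').hasFDerivAt
      have hfd : fderiv ℝ (fun θ' => g w.1 w.2 θ' i) = fun θ' =>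
          (EuclideanSpace.proj (𝕜 := ℝ) i).comp (fderiv ℝ (g w.1 w.2) θ') :=
        funext fun θ' => (hcoord θ').fderiv
      have h2 : Differentiable ℝ (fderiv ℝ (fun θ' => g w.1 w.2 θ' i)) := by
        rw [hfd]
        exact fun θ' => (differentiableAt_const _).clm_comp
          (hsmooth.twice_differentiable w.1 w.2 θ')
      have h3 := norm_sub_sub_fderiv_le (fun θ' => (hcoord θ').differentiableAt) h2
        (fun θ' hθ' => hΦ w.1 w.2 θ' hθ' i) hθ
      rw [hfd, ContinuousLinearMap.comp_apply] at h3
      have h4 := continuousLinearMap_apply_coord (fderiv ℝ (g w.1 w.2) θstar) v i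
      simp only [scoreCoord, scorePartial]
      rw [← h4, mul_comm]
      exact h3
    have hJ : (Matrix.toEuclideanCLM (n := Fin d) (𝕜 := ℝ) (meanJacobian P g a θstar) v) i =
        ∑ j, v j * meanJacobian P g a θstar i j := by
      rw [Matrix.ofLp_toEuclideanCLM]
      simp [Matrix.mulVec, dotProduct, mul_comm]
    have hsplit : (ipwScore g a (D.hist T ω) θ - ipwScore g a (D.hist T ω) θstar -
        Matrix.toEuclideanCLM (n := Fin d) (𝕜 := ℝ) (meanJacobian P g a θstar) v) i =
        ipwAvg D a (fun w => scoreCoord g θ i w - scoreCoord g θstar i w -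
          ∑ j, v j * scorePartial g θstar i j w) T ω +
        ∑ j, v j * (ipwAvg D a (scorePartial g θstar i j) T ω - meanJacobian P g a θstar i j) := by
      rw [PiLp.sub_apply, PiLp.sub_apply, ipwScore_apply, ipwScore_apply, hJ, ipwAvg_sub,
        ipwAvg_sub, ipwAvg_sum]
      simp only [ipwAvg_const_mul, mul_sub, Finset.sum_sub_distrib]
      ring
    rw [hsplit, add_comm]
    refine (abs_add_le _ _).trans (add_le_add ?_ ?_)
    · rw [Finset.sum_mul]
      refine (Finset.abs_sum_le_sum_abs _ _).trans (Finset.sum_le_sum fun j _ => ?_)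
      rw [abs_mul, mul_comm, Real.norm_eq_abs]
      gcongr
      exact abs_coord_le_norm v j
    · rw [ipwAvg_const_mul] at hrem
      exact hrem.trans (le_of_eq (by ring))

end Linearization

/-! ### The estimator and its limit law -/

section Estimator

/-- Measurable selection of a near-minimizer over a closed ball: the first point of a dense
sequence whose value is within `c` of the infimum over the sequence. -/
lemma exists_measurable_near_minimizer {α E : Type*} [MeasurableSpace α] [NormedAddCommGroup E]
    [SecondCountableTopology E] [MeasurableSpace E] {F : α → E → ℝ}
    (hF : ∀ θ, Measurable fun x => F x θ) (hcont : ∀ x, Continuous (F x)) (h0 : ∀ x θ, 0 ≤ F x θ)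
    {R c : ℝ} (hR : 0 ≤ R) (hc : 0 < c) :
    ∃ est : α → E, Measurable est ∧ (∀ x, ‖est x‖ ≤ R) ∧
      ∀ x θ, ‖θ‖ ≤ R → F x (est x) ≤ F x θ + c := by
  classical
  have : Nonempty (Metric.closedBall (0 : E) R) := ⟨⟨0, by simpa using hR⟩⟩
  set q : ℕ → Metric.closedBall (0 : E) R := TopologicalSpace.denseSeq _ with hq
  have hbdd : ∀ x, BddBelow (Set.range fun n => F x (q n)) := fun x =>
    ⟨0, by rintro _ ⟨n, rfl⟩; exact h0 _ _⟩
  have hex : ∀ x, ∃ n, F x (q n) ≤ (⨅ m, F x (q m)) + c := fun x => by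
    obtain ⟨n, hn⟩ := exists_lt_of_ciInf_lt (lt_add_of_pos_right (⨅ m, F x (q m)) hc)
    exact ⟨n, hn.le⟩
  have hinf : Measurable fun x => ⨅ m, F x (q m) := Measurable.iInf fun m => hF _
  refine ⟨fun x => q (Nat.find (hex x)), ?_, fun x => ?_, fun x θ hθ => ?_⟩
  · exact (measurable_from_nat (f := fun n => ((q n : Metric.closedBall (0 : E) R) : E))).comp
      (measurable_find hex fun k => measurableSet_le (hF _) (hinf.add_const c))
  · exact mem_closedBall_zero_iff.1 (q (Nat.find (hex x))).2
  · refine (Nat.find_spec (hex x)).trans (add_le_add ?_ le_rfl)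
    have hdense : ∀ θ' : Metric.closedBall (0 : E) R, (⨅ m, F x (q m)) ≤ F x θ' := fun θ' =>
      (TopologicalSpace.denseRange_denseSeq _).induction_on
        (p := fun θ' : Metric.closedBall (0 : E) R => (⨅ m, F x (q m)) ≤ F x θ') θ'
        (isClosed_le continuous_const ((hcont x).comp continuous_subtype_val))
        fun n => ciInf_le (hbdd x) n
    exact hdense ⟨θ, by simpa using hθ⟩

variable {Ω 𝒳 : Type*} [MeasurableSpace 𝒳] {mΩ : MeasurableSpace Ω} {K d : ℕ}
  {μ : Measure Ω} {P : Measure (𝒳 × (Fin K → ℝ))} {π : BehaviorPolicy 𝒳 K}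
  {D : Experiment Ω 𝒳 K} {a : Fin K} {pmin : ℝ} {g : 𝒳 → ℝ → Param d → Param d}
  {θstar : Param d} {R : ℝ} {πbar : StationaryPolicy 𝒳 K}

lemma measurable_ipwScore (hg : ∀ θ, Measurable fun z : 𝒳 × ℝ => g z.1 z.2 θ) (T : ℕ)
    (θ : Param d) : Measurable fun h : History 𝒳 K T => ipwScore g a h θ := by
  refine Measurable.fun_const_smul (g := fun h : History 𝒳 K T => ∑ t : Fin T,
    (1 / (h t).2.1 * (if (h t).2.2.1 = a then (1 : ℝ) else 0)) • g (h t).1 (h t).2.2.2 θ) ?_ _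
  refine Finset.measurable_sum _ fun t _ => (measurable_obs_weight t).smul ?_
  have h1 : Measurable fun h : History 𝒳 K T => h t := measurable_pi_apply t
  exact (hg θ).comp (h1.fst.prodMk h1.snd.snd.snd)

/-- Near-minimizers of `‖G_T‖` over the parameter ball solve the estimating equation up to
`o_p(T^{-1/2})`, because they do no worse than one Newton step from the true parameter. -/
lemma exists_ipwZEstimator [IsProbabilityMeasure μ] (hD : IsBanditExperiment μ P π D)
    (hunconf : Unconfounded μ D) (hpos : 0 < pmin)
    (hmin : ∀ t, ∀ᵐ ω ∂μ, pmin ≤ π t (D.X t ω) (D.hist t ω) a)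
    (hg : ∀ θ, Measurable fun z : 𝒳 × ℝ => g z.1 z.2 θ) (hroot : IsRoot P g a θstar)
    (hmom : BoundedMoments P g a θstar R) (hsmooth : SmoothScore P g a θstar R) :
    ∃ est : (T : ℕ) → History 𝒳 K T → Param d, (∀ T, Measurable (est T)) ∧
      IsIPWZSequence μ D g a R fun T ω => est T (D.hist T ω) := by
  have hR0 : 0 ≤ R := (norm_nonneg _).trans hmom.root_mem.le
  have hsel : ∀ T : ℕ, ∃ est : History 𝒳 K T → Param d, Measurable est ∧ (∀ x, ‖est x‖ ≤ R) ∧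
      ∀ x θ, ‖θ‖ ≤ R → ‖ipwScore g a x (est x)‖ ≤ ‖ipwScore g a x θ‖ + ((T : ℝ) + 1)⁻¹ :=
    fun T => exists_measurable_near_minimizer (F := fun x θ => ‖ipwScore g a x θ‖)
      (fun θ => (measurable_ipwScore hg T θ).norm)
      (fun x => (continuous_ipwScore hsmooth.differentiable x).norm) (fun _ _ => norm_nonneg _)
      hR0 (by positivity)
  choose est hmeas hball hnear using hsel
  refine ⟨est, hmeas, ⟨fun T => (hmeas T).comp (hD.measurable_hist T), fun T ω => hball T _, ?_⟩⟩
  set J := Matrix.toEuclideanCLM (n := Fin d) (𝕜 := ℝ) (meanJacobian P g a θstar) with hJ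
  set Jinv := Matrix.toEuclideanCLM (n := Fin d) (𝕜 := ℝ) (meanJacobian P g a θstar)⁻¹ with hJinv
  have hinv : ∀ v, J (Jinv v) = v := fun v => by
    rw [hJ, hJinv, ← mul_apply_eq_comp, ← map_mul,
      Matrix.mul_nonsing_inv _ hsmooth.nonsingular, map_one]
    rfl
  obtain ⟨hnewt, hnewt0⟩ := (hasLinearization_ipwScore hD hunconf hpos hmin hg hmom.root_mem
    hsmooth).newton_step hinv (boundedInProb_sqrt_smul_ipwScore hD hunconf hpos hmin hg hroot
      (memLp_scoreAt hg hmom hmom.root_mem.le))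
  refine tendstoInMeasure_zero_of_norm_le (tendstoInMeasure_zero_add
    (tendstoInMeasure_zero_norm hnewt0)
    (tendstoInMeasure_zero_of_tendsto tendsto_inv_sqrt_natCast)) ?_
  refine (tendstoInMeasure_zero_iff.1 hnewt (R - ‖θstar‖) (sub_pos.2 hmom.root_mem)).mono
    (Eventually.of_forall fun T ω hω => ?_)
  have hmem : ‖θstar - Jinv (ipwScore g a (D.hist T ω) θstar)‖ ≤ R := by
    have := norm_add_le (θstar - Jinv (ipwScore g a (D.hist T ω) θstar) - θstar) θstar
    rw [sub_add_cancel] at this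
    linarith
  have h1 := hnear T (D.hist T ω) _ hmem
  have h2 : √(T : ℝ) * ((T : ℝ) + 1)⁻¹ ≤ (√(T : ℝ))⁻¹ := by
    rcases (Real.sqrt_nonneg (T : ℝ)).eq_or_lt with h | h
    · simp [← h]
    · rw [← div_eq_mul_inv, div_le_iff₀ (by positivity), inv_mul_eq_div, le_div_iff₀ h,
        Real.mul_self_sqrt (Nat.cast_nonneg T)]
      linarith
  rw [norm_smul, norm_smul, Real.norm_of_nonneg (Real.sqrt_nonneg _)]
  calc √(T : ℝ) * ‖ipwScore g a (D.hist T ω) (est T (D.hist T ω))‖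
      ≤ √(T : ℝ) * (‖ipwScore g a (D.hist T ω)
          (θstar - Jinv (ipwScore g a (D.hist T ω) θstar))‖ + ((T : ℝ) + 1)⁻¹) := by gcongr
    _ ≤ _ := by
        rw [mul_add]
        gcongr

/-- Approximate solutions of the estimating equation in the parameter ball are consistent. -/
lemma IsIPWZSequence.consistent [IsProbabilityMeasure μ] (hD : IsBanditExperiment μ P π D)
    (hunconf : Unconfounded μ D) (hpos : 0 < pmin)
    (hmin : ∀ t, ∀ᵐ ω ∂μ, pmin ≤ π t (D.X t ω) (D.hist t ω) a)
    (hg : ∀ θ, Measurable fun z : 𝒳 × ℝ => g z.1 z.2 θ) (hsep : WellSeparated P g a θstar)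
    (hmom : BoundedMoments P g a θstar R) (hsmooth : SmoothScore P g a θstar R)
    {θhat : ℕ → Ω → Param d} (hθ : IsIPWZSequence μ D g a R θhat) :
    TendstoInMeasure μ (fun T ω => θhat T ω - θstar) atTop (fun _ => (0 : Param d)) := by
  have hP := isProbabilityMeasure_law hD
  obtain ⟨φ, hφm, hφ, hφint⟩ := hsmooth.gradient_bound
  have hφi : Integrable (fun z => φ z.1 (z.2 a)) P :=
    ((memLp_two_iff_integrable_sq
      (hφm.comp (measurable_armEval (a := a))).aestronglyMeasurable).2 hφint).integrable one_le_two
  have hlip : ∀ x y θ θ', ‖θ‖ ≤ R → ‖θ'‖ ≤ R → ‖g x y θ - g x y θ'‖ ≤ φ x y * ‖θ - θ'‖ :=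
    fun x y θ θ' h h' => (convex_closedBall (0 : Param d) R).norm_image_sub_le_of_norm_fderiv_le
      (fun θ _ => hsmooth.differentiable x y θ) (fun θ hθ => hφ x y θ (by simpa using hθ))
      (by simpa using h') (by simpa using h)
  refine tendstoInMeasure_of_approximate_zero
    (G := fun T ω θ => ipwScore g a (D.hist T ω) θ) (G₀ := fun θ => ∫ z, scoreAt g a θ z ∂P)
    (L := fun T ω => ∑ _i : Fin d, ipwAvg D a (fun w => φ w.1 w.2) T ω)
    (C := ∫ z, φ z.1 (z.2 a) ∂P)
    (fun θ h => tendstoInMeasure_ipwScore_sub hD hunconf hpos hmin hg (memLp_scoreAt hg hmom h))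
    (boundedInProb_sum _ fun i _ => boundedInProb_ipwAvg hD hunconf hpos hmin hφm hφi)
    (fun T ω θ θ' h h' => ?_) (fun θ θ' h h' => ?_) hsep hθ.norm_le
    (tendstoInMeasure_zero_of_sqrt_smul (boundedInProb_of_tendstoInMeasure_zero
      (tendstoInMeasure_zero_norm hθ.estimating_equation)))
  · refine (norm_le_sum_abs _).trans ?_
    rw [Finset.sum_mul]
    refine Finset.sum_le_sum fun i _ => ?_
    rw [PiLp.sub_apply, ipwScore_apply, ipwScore_apply, ← ipwAvg_sub, mul_comm, ← ipwAvg_const_mul]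
    refine abs_ipwAvg_le hD (fun w => ?_) T ω
    rw [mul_comm]
    exact (abs_coord_le_norm (g w.1 w.2 θ - g w.1 w.2 θ') i).trans (hlip w.1 w.2 θ θ' h h')
  · rw [← integral_sub ((memLp_scoreAt hg hmom h).integrable one_le_two)
      ((memLp_scoreAt hg hmom h').integrable one_le_two), ← integral_mul_const]
    exact norm_integral_le_of_norm_le (hφi.mul_const _)
      (ae_of_all _ fun z => hlip z.1 (z.2 a) θ θ' h h')

end Estimator

section AsymptoticNormality

variable {Ω 𝒳 : Type*} [MeasurableSpace 𝒳] {mΩ : MeasurableSpace Ω} {K d : ℕ}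
  {μ : Measure Ω} {P : Measure (𝒳 × (Fin K → ℝ))} {π : BehaviorPolicy 𝒳 K}
  {D : Experiment Ω 𝒳 K} {a : Fin K} {pmin : ℝ} {g : 𝒳 → ℝ → Param d → Param d}
  {θstar : Param d} {R : ℝ} {πbar : StationaryPolicy 𝒳 K}

lemma integrable_weightedOuter [IsProbabilityMeasure μ] (hD : IsBanditExperiment μ P π D)
    (hpos : 0 < pmin) (hmin : ∀ t, ∀ᵐ ω ∂μ, pmin ≤ π t (D.X t ω) (D.hist t ω) a)
    (hπbar : ∀ b, Measurable fun x => πbar x b) (hconv : PolicyConverges μ π D πbar a)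
    {θ : Param d} (h : MemLp (scoreAt g a θ) 2 P) (i j : Fin d) :
    Integrable (weightedOuter g πbar a θ i j) P := by
  have h1 := integrable_inv_limitPolicy_mul hD hpos hmin hπbar hconv
    ((memLp_scoreCoord h i).integrable_mul (memLp_scoreCoord h j))
  refine h1.congr (ae_of_all _ fun z => ?_)
  simp [weightedOuter, one_div, scoreCoord, armEval, scoreAt]

/-- The quadratic form of `Ī` is the variance of the linear combinations of the score. -/
lemma dotProduct_weightedInformation_mulVec
    {θ : Param d} (h : ∀ i j, Integrable (weightedOuter g πbar a θ i j) P) (w : Fin d → ℝ) :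
    w ⬝ᵥ (weightedInformation P g πbar a θ).mulVec w =
      ∫ z, (πbar z.1 a : ℝ)⁻¹ * (∑ i, w i * scoreCoord g θ i (armEval a z)) ^ 2 ∂P := by
  have h1 : ∀ z : 𝒳 × (Fin K → ℝ), (πbar z.1 a : ℝ)⁻¹ *
      (∑ i, w i * scoreCoord g θ i (armEval a z)) ^ 2 =
      ∑ i, ∑ j, w i * w j * weightedOuter g πbar a θ i j z := fun z => by
    rw [sq, Finset.sum_mul_sum, Finset.mul_sum]
    refine Finset.sum_congr rfl fun i _ => ?_
    rw [Finset.mul_sum]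
    refine Finset.sum_congr rfl fun j _ => ?_
    simp only [weightedOuter, scoreCoord, armEval, scoreAt]
    ring
  simp only [h1]
  rw [integral_finsetSum _ fun i _ => integrable_finsetSum _ fun j _ => (h i j).const_mul _]
  simp only [dotProduct, Matrix.mulVec, weightedInformation, Matrix.of_apply]
  refine Finset.sum_congr rfl fun i _ => ?_
  rw [integral_finsetSum _ fun j _ => (h i j).const_mul _, Finset.mul_sum]
  refine Finset.sum_congr rfl fun j _ => ?_
  rw [integral_const_mul]
  ring

lemma posSemidef_asymptoticCov {θ : Param d}
    (h : ∀ i j, Integrable (weightedOuter g πbar a θ i j) P) :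
    (asymptoticCov P g πbar a θ).PosSemidef := by
  have hI : (weightedInformation P g πbar a θ).PosSemidef := by
    refine Matrix.PosSemidef.of_dotProduct_mulVec_nonneg ?_ fun w => ?_
    · ext i j
      simp only [Matrix.conjTranspose_apply, weightedInformation, Matrix.of_apply, star_trivial]
      refine integral_congr_ae (ae_of_all _ fun z => ?_)
      simp only [weightedOuter]
      ring
    · rw [star_trivial, dotProduct_weightedInformation_mulVec h]
      exact integral_nonneg fun z =>
        mul_nonneg (inv_nonneg.2 (stdSimplex_nonneg _ a)) (sq_nonneg _)
  have := hI.mul_mul_conjTranspose_same (meanJacobian P g a θ)⁻¹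
  rwa [Matrix.conjTranspose_eq_transpose_of_trivial] at this

/-- The influence terms `-J⁻¹ √T G_T(θ*)` are asymptotically normal: along each direction `u` their
characteristic function is that of a weighted average of the centered function
`-⟨J⁻ᵀ u, g(·; θ*)⟩`. -/
lemma tendstoInDistribution_neg_inv_ipwScore [IsProbabilityMeasure μ]
    (hD : IsBanditExperiment μ P π D)
    (hunconf : Unconfounded μ D) (hpos : 0 < pmin)
    (hmin : ∀ t, ∀ᵐ ω ∂μ, pmin ≤ π t (D.X t ω) (D.hist t ω) a)
    (hπbar : ∀ b, Measurable fun x => πbar x b) (hconv : PolicyConverges μ π D πbar a)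
    (hg : ∀ θ, Measurable fun z : 𝒳 × ℝ => g z.1 z.2 θ) (hroot : IsRoot P g a θstar)
    (h4 : MemLp (scoreAt g a θstar) 4 P) :
    TendstoInDistribution (fun (T : ℕ) ω => -Matrix.toEuclideanCLM (n := Fin d) (𝕜 := ℝ)
        (meanJacobian P g a θstar)⁻¹ (√(T : ℝ) • ipwScore g a (D.hist T ω) θstar)) atTop id
      (fun _ => μ) (multivariateGaussian 0 (asymptoticCov P g πbar a θstar)) := by
  have hP := isProbabilityMeasure_law hD
  have hout := integrable_weightedOuter hD hpos hmin hπbar hconv (h4.mono_exponent (by norm_num))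
  have hpsd := posSemidef_asymptoticCov hout
  set M := (meanJacobian P g a θstar)⁻¹ with hM
  have hmeas : ∀ T : ℕ, Measurable fun ω => -Matrix.toEuclideanCLM (n := Fin d) (𝕜 := ℝ) M
      (√(T : ℝ) • ipwScore g a (D.hist T ω) θstar) := fun T => by
    have h1 : Measurable fun ω => ipwScore g a (D.hist T ω) θstar :=
      (measurable_ipwScore hg T θstar).comp (hD.measurable_hist T)
    exact ((Matrix.toEuclideanCLM (n := Fin d) (𝕜 := ℝ) M).continuous.measurable.comp
      (h1.const_smul (√(T : ℝ)))).neg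
  refine ⟨fun T => (hmeas T).aemeasurable, aemeasurable_id,
    ProbabilityMeasure.tendsto_of_tendsto_charFun fun u => ?_⟩
  set w : Fin d → ℝ := M.transpose.mulVec u with hw
  set f : 𝒳 × ℝ → ℝ := fun y => ∑ i, -w i * scoreCoord g θstar i y with hf
  have hfm : Measurable f :=
    Finset.measurable_sum _ fun i _ => (measurable_scoreCoord hg θstar i).const_mul _
  have hf4 : MemLp (fun z => f (armEval a z)) 4 P :=
    memLp_finsetSum _ fun i _ => (memLp_scoreCoord h4 i).const_mul _
  have hf0 : ∫ z, f (armEval a z) ∂P = 0 := by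
    simp only [hf]
    rw [integral_finsetSum _ fun i _ =>
      ((memLp_scoreCoord h4 i).integrable (by norm_num)).const_mul _]
    refine Finset.sum_eq_zero fun i _ => ?_
    rw [integral_const_mul, ← integral_scoreAt_apply hroot.1, hroot.2]
    simp
  have hclt := tendsto_integral_cexp_sqrt_mul_ipwAvg hD hunconf hpos hmin hπbar hconv hfm hf4 hf0
  have hvar : ∫ z, (πbar z.1 a : ℝ)⁻¹ * f (armEval a z) ^ 2 ∂P =
      u ⬝ᵥ (asymptoticCov P g πbar a θstar).mulVec u := by
    have h1 := dotProduct_weightedInformation_mulVec hout (fun i => -w i)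
    rw [← h1, show (fun i => -w i) = -w from rfl, Matrix.mulVec_neg, neg_dotProduct,
      dotProduct_neg, neg_neg, asymptoticCov, ← hM, ← Matrix.mulVec_mulVec, ← Matrix.mulVec_mulVec,
      Matrix.dotProduct_mulVec u M, ← Matrix.mulVec_transpose]
  have hinner : ∀ (T : ℕ) ω, inner ℝ (-Matrix.toEuclideanCLM (n := Fin d) (𝕜 := ℝ) M
      (√(T : ℝ) • ipwScore g a (D.hist T ω) θstar)) u = √(T : ℝ) * ipwAvg D a f T ω := by
    intro T ω
    have h1 : ipwAvg D a f T ω = -(w ⬝ᵥ (ipwScore g a (D.hist T ω) θstar).ofLp) := by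
      rw [hf, ipwAvg_sum, dotProduct, ← Finset.sum_neg_distrib]
      refine Finset.sum_congr rfl fun i _ => ?_
      rw [ipwAvg_const_mul, ipwScore_apply, neg_mul]
    have h2 : inner ℝ (Matrix.toEuclideanCLM (n := Fin d) (𝕜 := ℝ) M
        (ipwScore g a (D.hist T ω) θstar)) u =
        w ⬝ᵥ (ipwScore g a (D.hist T ω) θstar).ofLp := by
      rw [real_inner_comm, Matrix.inner_toEuclideanCLM, hw, Matrix.dotProduct_mulVec,
        Matrix.mulVec_transpose]
    rw [inner_neg_left, map_smul, real_inner_smul_left, h1, h2, mul_neg]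
  have hlim : charFun (multivariateGaussian 0 (asymptoticCov P g πbar a θstar)) u =
      (Real.exp (-((∫ z, (πbar z.1 a : ℝ)⁻¹ * f (armEval a z) ^ 2 ∂P) / 2)) : ℝ) := by
    rw [charFun_multivariateGaussian hpsd, hvar, inner_zero_right]
    push_cast
    congr 1
    ring
  simp only [ProbabilityMeasure.coe_mk, Measure.map_id]
  rw [hlim]
  refine hclt.congr fun T => ?_
  rw [charFun_apply, integral_map (hmeas T).aemeasurable (by fun_prop)]
  simp only [hinner]

end AsymptoticNormality

end BanditInference

theorem theorem1 {Ω : Type*} [MeasurableSpace Ω] (μ : Measure Ω) [IsProbabilityMeasure μ]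
    {dX d K : ℕ} (𝒳 : Set (EuclideanSpace ℝ (Fin dX)))
    (P : Measure (𝒳 × (Fin K → ℝ)))
    (π : BehaviorPolicy 𝒳 K) (D : Experiment Ω 𝒳 K)
    (hD : IsBanditExperiment μ P π D)
    (hunconf : Unconfounded μ D)
    (g : 𝒳 → ℝ → Param d → Param d)
    (hg : ∀ θ, Measurable fun z : 𝒳 × ℝ => g z.1 z.2 θ)
    (a : Fin K) (θstar : Param d) (R : ℝ)
    (hroot : IsRoot P g a θstar)
    (hsep : WellSeparated P g a θstar)
    (hmom : BoundedMoments P g a θstar R)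
    (hsmooth : SmoothScore P g a θstar R)
    (hmin : MinSamplingProb μ π D a)
    (πbar : StationaryPolicy 𝒳 K) (hπbar : ∀ b, Measurable fun x => πbar x b)
    (hconv : PolicyConverges μ π D πbar a) :
    ((∀ i j, Integrable (weightedOuter g πbar a θstar i j) P) ∧
      (asymptoticCov P g πbar a θstar).PosSemidef) ∧
    (∃ est : (T : ℕ) → History 𝒳 K T → Param d, (∀ T, Measurable (est T)) ∧
      IsIPWZSequence μ D g a R fun T ω => est T (D.hist T ω)) ∧
    ∀ θhat : ℕ → Ω → Param d, IsIPWZSequence μ D g a R θhat →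
      TendstoInDistribution (fun (T : ℕ) ω => √(T : ℝ) • (θhat T ω - θstar)) atTop id
        (fun _ => μ) (multivariateGaussian 0 (asymptoticCov P g πbar a θstar)) := by
  obtain ⟨pmin, ⟨hpos, -⟩, hmin⟩ := hmin
  have hmem2 : MemLp (scoreAt g a θstar) 2 P := memLp_scoreAt hg hmom hmom.root_mem.le
  have hout := integrable_weightedOuter hD hpos hmin hπbar hconv hmem2
  refine ⟨⟨hout, posSemidef_asymptoticCov hout⟩,
    exists_ipwZEstimator hD hunconf hpos hmin hg hroot hmom hsmooth, fun θhat hθ => ?_⟩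
  have hinv : ∀ v, Matrix.toEuclideanCLM (n := Fin d) (𝕜 := ℝ) (meanJacobian P g a θstar)⁻¹
      (Matrix.toEuclideanCLM (n := Fin d) (𝕜 := ℝ) (meanJacobian P g a θstar) v) = v := fun v => by
    rw [← mul_apply_eq_comp, ← map_mul,
      Matrix.nonsing_inv_mul _ hsmooth.nonsingular, map_one]
    rfl
  have hrep := (hasLinearization_ipwScore hD hunconf hpos hmin hg hmom.root_mem
    hsmooth).tendstoInMeasure_sqrt_smul_add hinv
    (boundedInProb_sqrt_smul_ipwScore hD hunconf hpos hmin hg hroot hmem2)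
    (hθ.consistent hD hunconf hpos hmin hg hsep hmom hsmooth) hθ.estimating_equation
  refine tendstoInDistribution_of_tendstoInMeasure_sub _ _
    (tendstoInDistribution_neg_inv_ipwScore hD hunconf hpos hmin hπbar hconv hg hroot
      (memLp_four_scoreAt hg hmom)) ?_ fun T =>
    (((hθ.measurable T).sub_const θstar).const_smul (√(T : ℝ))).aemeasurable
  refine hrep.congr_left fun T => ae_of_all _ fun ω => ?_
  simp only [Pi.sub_apply, sub_neg_eq_add]
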